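/- Let $(M,g)$ be a closed (compact, without boundary) smooth Riemannian manifold of dimension $n$, let $k\in\mathbb{R}$, and let $A\in\Psi^k_{\mathrm{cl}}(M)$ be a classical pseudodifferential operator of order $k$: a linear map $A\colon C^\infty(M)\to C^\infty(M)$ on complex-valued functions such that for every smooth chart $\kappa\colon U\to\tilde U\subset\mathbb{R}^n$ and all $\varphi,\psi\in C_c^\infty(\tilde U)$ the operator $u\mapsto\varphi\,(\kappa^{-1})^*A\,\kappa^*(\psi u)$ on Schwartz functions has the form $$\mathrm{Op}(a)u(x)=(2\pi)^{-n}\iint e^{i(x-y)\cdot\xi}a(x,\xi)u(y)\,dy\,d\xi ,$$ where $a\in S^k(\mathbb{R}^n\times\mathbb{R}^n)$ has an asymptotic expansion $a\sim\sum_{j\ge0}a_{k-j}$ with $a_{k-j}$ smooth on $\mathbb{R}^n\times(\mathbb{R}^n\setminus\{0\})$ and homogeneous of degree $k-j$ in $\xi$. Let $\sigma_k(A)\colon T^*M\setminus 0\to\mathbb{C}$ be its principal symbol, given in a chart $\kappa$ by $\sigma_k(A)(x,\kappa^*\eta)=a_k(\kappa(x),\eta)$, where $a_k$ is the leading term for cutoffs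 with $\varphi(\kappa(x))=\psi(\kappa(x))=1$. Then $$\sup_{(x,\xi)\in T^*M\setminus 0}|\xi|_g^{-k}\,|\sigma_k(A)(x,\xi)|\;\le\;\|A\|_{H^k(M)\to L^2(M)} ,$$ where $|\xi|_g$ is the length of the covector $\xi$, $\|u\|_{L^2}^2=\int_M|u|^2\,dV_g$, $\|u\|_{H^k}=\|(1+\Delta)^{k/2}u\|_{L^2}$ with $\Delta\ge0$ the Laplace–Beltrami operator of $g$ and $(1+\Delta)^{k/2}$ defined by its eigenfunction expansion, and $\|A\|_{H^k\to L^2}$ is the least $C\in[0,\infty]$ with $\|Au\|_{L^2}\le C\|u\|_{H^k}$ for all $u\in C^\infty(M)$. -/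

import Mathlib

open scoped Manifold ContDiff SchwartzMap Distributions ENNReal NNReal

noncomputable section

namespace PsiDO

/-- The model space `ℝⁿ` with its Euclidean structure. -/
abbrev Rn (n : ℕ) : Type := EuclideanSpace ℝ (Fin n)

/-! ### Symbols and quantization on `ℝⁿ` -/

/-- `mixedDeriv p q a x ξ` is the full tensor of derivatives of `a` at `(x, ξ)` of order `p` in the
space variable and of order `q` in the frequency variable. -/
def mixedDeriv {n : ℕ} (p q : ℕ) (a : Rn n → Rn n → ℂ) (x ξ : Rn n) :=
  iteratedFDeriv ℝ q (fun ζ : Rn n => iteratedFDeriv ℝ p (fun z : Rn n => a z ζ) x) ξ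

/-- The Kohn–Nirenberg class `S^m(ℝⁿ × ℝⁿ)`: smooth functions `a(x, ξ)` with
`|∂_x^β ∂_ξ^α a(x, ξ)| ≤ C_{α,β} (1 + |ξ|)^{m - |α|}`. -/
def IsSymbol {n : ℕ} (m : ℝ) (a : Rn n → Rn n → ℂ) : Prop :=
  ContDiff ℝ ∞ (fun z : Rn n × Rn n => a z.1 z.2) ∧
    ∀ p q : ℕ, ∃ C : ℝ, ∀ x ξ : Rn n, ‖mixedDeriv p q a x ξ‖ ≤ C * (1 + ‖ξ‖) ^ (m - (q : ℝ))

/-- `a ∈ S^m` is classical (polyhomogeneous) with asymptotic expansion `a ∼ ∑_j b_j`, where `b_j` is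
smooth on `ℝⁿ × (ℝⁿ ∖ 0)` and homogeneous of degree `m - j` in `ξ`: away from `ξ = 0` each remainder
`a - ∑_{j < N} b_j` is a symbol of order `m - N`. The values `b_j(x, 0)` play no role. -/
structure IsClassicalSymbol {n : ℕ} (m : ℝ) (a : Rn n → Rn n → ℂ)
    (b : ℕ → Rn n → Rn n → ℂ) : Prop where
  symbol : IsSymbol m a
  smooth : ∀ j, ContDiffOn ℝ ∞ (fun z : Rn n × Rn n => b j z.1 z.2) {z | z.2 ≠ 0}
  homogeneous : ∀ (j : ℕ) (x ξ : Rn n) (t : ℝ), ξ ≠ 0 → 0 < t →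
    b j x (t • ξ) = ((t ^ (m - (j : ℝ)) : ℝ) : ℂ) * b j x ξ
  remainder : ∀ N p q : ℕ, ∃ C : ℝ, ∀ x ξ : Rn n, 1 ≤ ‖ξ‖ →
    ‖mixedDeriv p q (fun y η => a y η - ∑ j ∈ Finset.range N, b j y η) x ξ‖
      ≤ C * (1 + ‖ξ‖) ^ (m - (N : ℝ) - (q : ℝ))

/-- The quantization
`Op(a) u (x) = (2π)^{-n} ∫ e^{i x·ξ} a(x, ξ) (∫ e^{-i y·ξ} u(y) dy) dξ`. -/
def Op {n : ℕ} (a : Rn n → Rn n → ℂ) (u : 𝓢(Rn n, ℂ)) (x : Rn n) : ℂ :=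
  (((2 * Real.pi) ^ n : ℝ) : ℂ)⁻¹ *
    ∫ ξ : Rn n, Complex.exp (Complex.I * ((inner ℝ x ξ : ℝ) : ℂ)) * a x ξ *
      ∫ y : Rn n, Complex.exp (-(Complex.I * ((inner ℝ y ξ : ℝ) : ℂ))) * u y

/-! ### Classical pseudodifferential operators on a manifold -/

section Manifold

variable {n : ℕ} (M : Type*) [TopologicalSpace M] [ChartedSpace (Rn n) M]

/-- The complex vector space `C^∞(M)` of smooth complex-valued functions. -/
def Smooth (n : ℕ) (M : Type*) [TopologicalSpace M] [ChartedSpace (Rn n) M] :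
    Submodule ℂ (M → ℂ) where
  carrier := {f | ContMDiff (𝓡 n) 𝓘(ℝ, ℂ) ∞ f}
  add_mem' hf hg := ContMDiff.add hf hg
  zero_mem' := contMDiff_const
  smul_mem' c f hf := by
    have h : ContMDiff (𝓡 n) 𝓘(ℝ, ℂ) ∞ (fun x => c * f x) := by
      have h2 : ContDiff ℝ ∞ (fun z : ℂ => c * z) := contDiff_const.mul contDiff_id
      exact h2.contMDiff.comp hf
    exact h

variable {M}

/-- `Charts n M` consists of all smooth local coordinates of `M`: the maximal atlas. -/
abbrev Charts (n : ℕ) (M : Type*) [TopologicalSpace M] [ChartedSpace (Rn n) M] :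
    Set (OpenPartialHomeomorph M (Rn n)) :=
  IsManifold.maximalAtlas (𝓡 n) ∞ M

/-- The open subset of `ℝⁿ` which is the image of a chart. -/
abbrev chartImage (κ : OpenPartialHomeomorph M (Rn n)) : TopologicalSpace.Opens (Rn n) :=
  ⟨κ.target, κ.open_target⟩

theorem contMDiff_pullback [T2Space M] [IsManifold (𝓡 n) ∞ M]
    {κ : OpenPartialHomeomorph M (Rn n)} (hκ : κ ∈ Charts n M)
    (ψ : 𝓓(chartImage κ, ℂ)) (u : 𝓢(Rn n, ℂ)) :
    ContMDiff (𝓡 n) 𝓘(ℝ, ℂ) ∞ (κ.source.indicator fun p => ψ (κ p) * u (κ p)) := by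
  have hK : IsCompact (κ.symm '' tsupport ψ) :=
    ψ.hasCompactSupport.isCompact.image_of_continuousOn
      (κ.symm.continuousOn.mono ψ.tsupport_subset)
  have hsub : tsupport (κ.source.indicator fun p => ψ (κ p) * u (κ p)) ⊆ κ.symm '' tsupport ψ := by
    refine closure_minimal (fun p hp => ?_) hK.isClosed
    have hps : p ∈ κ.source := by
      by_contra h
      exact hp (Set.indicator_of_notMem h _)
    refine ⟨κ p, subset_tsupport _ fun h => hp ?_, κ.left_inv hps⟩
    rw [Set.indicator_of_mem hps, h, zero_mul]
  refine contMDiff_of_tsupport fun p hp => ?_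
  obtain ⟨y, hy, rfl⟩ := hsub hp
  have hps : κ.symm y ∈ κ.source := κ.map_target (ψ.tsupport_subset hy)
  have h1 : ContDiff ℝ ∞ fun z : Rn n => ψ z * u z := ψ.contDiff.mul (u.smooth ⊤)
  have h2 : ContMDiffAt (𝓡 n) 𝓘(ℝ, ℂ) ∞ (fun p => ψ (κ p) * u (κ p)) (κ.symm y) :=
    h1.contMDiff.contMDiffAt.comp (κ.symm y) (contMDiffAt_of_mem_maximalAtlas hκ hps)
  refine h2.congr_of_eventuallyEq ?_
  filter_upwards [κ.open_source.mem_nhds hps] with q hq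
  exact Set.indicator_of_mem hq _

/-- The function `κ^*(ψ u)` on `M`, extended by zero outside the domain of the chart `κ`. -/
def pullback [T2Space M] [IsManifold (𝓡 n) ∞ M]
    {κ : OpenPartialHomeomorph M (Rn n)} (hκ : κ ∈ Charts n M)
    (ψ : 𝓓(chartImage κ, ℂ)) (u : 𝓢(Rn n, ℂ)) : Smooth n M :=
  ⟨κ.source.indicator fun p => ψ (κ p) * u (κ p), contMDiff_pullback hκ ψ u⟩

/-- `a` is the full symbol of `A` in the chart `κ`, localized by the cutoffs `φ, ψ`: the operator
`u ↦ φ · (κ⁻¹)^* A κ^*(ψ u)` on `ℝⁿ` equals `Op(a)`. -/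
def IsLocalSymbol [T2Space M] [IsManifold (𝓡 n) ∞ M] (A : Smooth n M →ₗ[ℂ] Smooth n M)
    {κ : OpenPartialHomeomorph M (Rn n)} (hκ : κ ∈ Charts n M)
    (φ ψ : 𝓓(chartImage κ, ℂ)) (a : Rn n → Rn n → ℂ) : Prop :=
  ∀ (u : 𝓢(Rn n, ℂ)) (y : Rn n), φ y * (A (pullback hκ ψ u) : M → ℂ) (κ.symm y) = Op a u y

/-- `A ∈ Ψ^k_cl(M)`: in every chart (charts with disconnected domain included) and for all cutoffs
supported in its image, the localized operator is the quantization of a classical symbol of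
order `k`. -/
def IsClassicalPDO [T2Space M] [IsManifold (𝓡 n) ∞ M] (k : ℝ)
    (A : Smooth n M →ₗ[ℂ] Smooth n M) : Prop :=
  ∀ (κ : OpenPartialHomeomorph M (Rn n)) (hκ : κ ∈ Charts n M) (φ ψ : 𝓓(chartImage κ, ℂ)),
    ∃ (a : Rn n → Rn n → ℂ) (b : ℕ → Rn n → Rn n → ℂ),
      IsClassicalSymbol k a b ∧ IsLocalSymbol A hκ φ ψ a

/-- `c` is the value at `(x, ξ)` of the principal symbol of order `k` of `A`: in a chart `κ` around
`x`, with cutoffs equal to `1` at `κ x`, the leading homogeneous term of the local symbol takes the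
value `c` at `(κ x, η)`, where `ξ = κ^* η`. -/
def HasPrincipalSymbolAt [T2Space M] [IsManifold (𝓡 n) ∞ M] (k : ℝ)
    (A : Smooth n M →ₗ[ℂ] Smooth n M) (x : M) (ξ : TangentSpace (𝓡 n) x →L[ℝ] ℝ) (c : ℂ) : Prop :=
  ∃ (κ : OpenPartialHomeomorph M (Rn n)) (hκ : κ ∈ Charts n M) (φ ψ : 𝓓(chartImage κ, ℂ))
    (a : Rn n → Rn n → ℂ) (b : ℕ → Rn n → Rn n → ℂ) (η : Rn n),
    x ∈ κ.source ∧ φ (κ x) = 1 ∧ ψ (κ x) = 1 ∧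
    IsClassicalSymbol k a b ∧ IsLocalSymbol A hκ φ ψ a ∧
    (∀ v : TangentSpace (𝓡 n) x, ξ v = inner ℝ η (mfderiv (𝓡 n) (𝓡 n) κ x v : Rn n)) ∧
    c = b 0 (κ x) η

theorem exists_hasPrincipalSymbolAt [T2Space M] [IsManifold (𝓡 n) ∞ M] {k : ℝ}
    {A : Smooth n M →ₗ[ℂ] Smooth n M} (hA : IsClassicalPDO k A) (x : M)
    (ξ : TangentSpace (𝓡 n) x →L[ℝ] ℝ) : ∃ c, HasPrincipalSymbolAt k A x ξ c := by
  have hκ : chartAt (Rn n) x ∈ Charts n M := IsManifold.chart_mem_maximalAtlas x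
  have hx := mem_chart_source (Rn n) x
  generalize chartAt (Rn n) x = κ at hκ hx
  obtain ⟨f, hf, hfc, hfs, -, hf1⟩ := exists_contDiff_tsupport_subset (n := ⊤)
    (κ.open_target.mem_nhds (κ.map_source hx))
  let φ : 𝓓(chartImage κ, ℂ) :=
    { toFun := fun y => (f y : ℂ)
      contDiff' := Complex.ofRealCLM.contDiff.comp hfs
      hasCompactSupport' := hfc.comp_left Complex.ofReal_zero
      tsupport_subset' := (tsupport_comp_subset Complex.ofReal_zero f).trans hf }
  have hφ : φ (κ x) = 1 := by
    change ((f (κ x) : ℝ) : ℂ) = 1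
    rw [hf1, Complex.ofReal_one]
  obtain ⟨a, b, hab, hloc⟩ := hA κ hκ φ φ
  have hd : κ.MDifferentiable (𝓡 n) (𝓡 n) :=
    ⟨(contMDiffOn_of_mem_maximalAtlas hκ).mdifferentiableOn (by simp),
      (contMDiffOn_symm_of_mem_maximalAtlas hκ).mdifferentiableOn (by simp)⟩
  let T : TangentSpace (𝓡 n) x ≃L[ℝ] Rn n := hd.mfderiv hx
  let η : Rn n := (InnerProductSpace.toDual ℝ (Rn n)).symm
    (ξ.comp (T.symm : Rn n →L[ℝ] TangentSpace (𝓡 n) x))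
  refine ⟨b 0 (κ x) η, κ, hκ, φ, φ, a, b, η, hx, hφ, hφ, hab, hloc, fun v => ?_, rfl⟩
  change ξ v = inner ℝ η (T v)
  simp [η]

/-- The principal symbol `σ_k(A)(x, ξ)` of `A ∈ Ψ^k_cl(M)`, for `ξ ∈ T_x^*M ∖ 0`. By the change of
coordinates formula for symbols its value does not depend on the chart and the cutoffs. -/
def principalSymbol [T2Space M] [IsManifold (𝓡 n) ∞ M] {k : ℝ}
    {A : Smooth n M →ₗ[ℂ] Smooth n M} (hA : IsClassicalPDO k A) (x : M)
    (ξ : TangentSpace (𝓡 n) x →L[ℝ] ℝ) : ℂ :=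
  (exists_hasPrincipalSymbolAt hA x ξ).choose

end Manifold

/-! ### Riemannian geometry -/

/-- Smooth Riemannian metrics on `M`. -/
abbrev Metric (n : ℕ) (M : Type*) [TopologicalSpace M] [ChartedSpace (Rn n) M]
    [IsManifold (𝓡 n) ∞ M] :=
  Bundle.ContMDiffRiemannianMetric (𝓡 n) ∞ (Rn n) (fun x : M => TangentSpace (𝓡 n) x)

section Riemannian

variable {n : ℕ} {M : Type*} [TopologicalSpace M] [ChartedSpace (Rn n) M] [IsManifold (𝓡 n) ∞ M]

/-- A basis of the tangent space `T_x M`. -/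
def tangentBasis (x : M) (i : Fin n) : TangentSpace (𝓡 n) x :=
  (EuclideanSpace.single i (1 : ℝ) : Rn n)

/-- The Gram matrix of the metric at `x`. -/
def gram (g : Metric n M) (x : M) : Matrix (Fin n) (Fin n) ℝ :=
  Matrix.of fun i j => g.inner x (tangentBasis x i) (tangentBasis x j)

/-- The bilinear pairing `⟨α, β⟩_g = ∑ g^{ij} α_i β_j` of (real or complex) covectors at `x`. -/
def cometric {F : Type*} [RCLike F] (g : Metric n M) (x : M)
    (α β : TangentSpace (𝓡 n) x →L[ℝ] F) : F :=
  ∑ i, ∑ j, ((gram g x)⁻¹ i j) • (α (tangentBasis x i) * β (tangentBasis x j))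

/-- The length `|ξ|_g` of a cotangent vector. -/
def covectorNorm (g : Metric n M) (x : M) (ξ : TangentSpace (𝓡 n) x →L[ℝ] ℝ) : ℝ :=
  Real.sqrt (cometric g x ξ ξ)

/-- The coefficients `g_{ij}` of the metric in the chart `κ`, at the point with coordinates `y`. -/
def chartGram (g : Metric n M) (κ : OpenPartialHomeomorph M (Rn n)) (y : Rn n) :
    Matrix (Fin n) (Fin n) ℝ :=
  Matrix.of fun i j => g.inner (κ.symm y)
    (mfderiv (𝓡 n) (𝓡 n) κ.symm y (EuclideanSpace.single i (1 : ℝ) : Rn n))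
    (mfderiv (𝓡 n) (𝓡 n) κ.symm y (EuclideanSpace.single j (1 : ℝ) : Rn n))

/-- The Riemannian volume on the domain of a chart: `√(det g_{ij}) dy`, transported to `M`. -/
def chartVolume [MeasurableSpace M] (g : Metric n M) (κ : OpenPartialHomeomorph M (Rn n)) :
    MeasureTheory.Measure M :=
  (((MeasureTheory.volume : MeasureTheory.Measure (Rn n)).restrict κ.target).withDensity
    fun y => ENNReal.ofReal (Real.sqrt (chartGram g κ y).det)).map κ.symm

/-- The Riemannian volume measure `dV_g`. The measures of the charts agree on overlaps, and their
supremum in the lattice of measures is the measure glued from them. -/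
def vol [MeasurableSpace M] (g : Metric n M) : MeasureTheory.Measure M :=
  ⨆ κ ∈ Charts n M, chartVolume g κ

/-- The differential of a smooth function. -/
def differential (f : Smooth n M) (x : M) : TangentSpace (𝓡 n) x →L[ℝ] ℂ :=
  mfderiv (𝓡 n) 𝓘(ℝ, ℂ) (f : M → ℂ) x

/-- `Δ f = w` for the nonnegative Laplace–Beltrami operator `Δ = d^* d`, where `d^*` is the formal
adjoint of `d`: `∫ ⟨df, dh⟩ dV = ∫ w h dV` for all `h ∈ C^∞(M)`. -/
def IsLaplacian [MeasurableSpace M] (g : Metric n M) (f w : Smooth n M) : Prop :=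
  ∀ h : Smooth n M,
    ∫ x, cometric g x (differential f x) (differential h x) ∂(vol g) =
      ∫ x, (w : M → ℂ) x * (h : M → ℂ) x ∂(vol g)

/-- `Δ f = μ f` (the zero function is included). -/
def IsEigenfunction [MeasurableSpace M] (g : Metric n M) (μ : ℝ≥0) (f : Smooth n M) : Prop :=
  IsLaplacian g f (((μ : ℝ) : ℂ) • f)

/-- The norm of `L²(M, dV_g)`. -/
def l2Norm [MeasurableSpace M] (g : Metric n M) (u : Smooth n M) : ℝ≥0∞ :=
  MeasureTheory.eLpNorm (u : M → ℂ) 2 (vol g)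

/-- The `L²`-norm of `P_μ u`, where `P_μ` is the orthogonal projection of `L²(M)` onto the eigenspace
of `Δ` for `μ`, as `sup |⟨u, f⟩| / ‖f‖` over the eigenspace. -/
def spectralPart [MeasurableSpace M] (g : Metric n M) (μ : ℝ≥0) (u : Smooth n M) : ℝ≥0∞ :=
  ⨆ (f : Smooth n M) (_ : IsEigenfunction g μ f),
    ‖∫ x, (u : M → ℂ) x * starRingEnd ℂ ((f : M → ℂ) x) ∂(vol g)‖ₑ / l2Norm g f

/-- The Sobolev norm `‖u‖_{H^s} = ‖(1 + Δ)^{s/2} u‖_{L²}`, through the spectral decomposition of `Δ`: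
`(1 + Δ)^{s/2} u = ∑_μ (1 + μ)^{s/2} P_μ u`, an orthogonal sum over the eigenvalues `μ ≥ 0`
(`P_μ = 0` if `μ` is not an eigenvalue). -/
def sobolevNorm [MeasurableSpace M] (g : Metric n M) (s : ℝ) (u : Smooth n M) : ℝ≥0∞ :=
  (∑' μ : ℝ≥0, ((1 + (μ : ℝ≥0∞)) ^ (s / 2) * spectralPart g μ u) ^ 2) ^ (1 / 2 : ℝ)

/-- The operator norm `‖A‖_{H^s → L²} ∈ [0, ∞]`, computed on the dense subspace `C^∞(M)` of `H^s`. -/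
def sobolevOpNorm [MeasurableSpace M] (g : Metric n M) (s : ℝ)
    (A : Smooth n M →ₗ[ℂ] Smooth n M) : ℝ≥0∞ :=
  sInf {C : ℝ≥0∞ | ∀ u : Smooth n M, l2Norm g (A u) ≤ C * sobolevNorm g s u}

end Riemannian

end PsiDO

end

/-! The operator is tested on wave packets. Fix a chart, a covector `η ≠ 0` and a bump function `c`,
and put `v_t = e^{i t y·η} c` with `t → ∞`. In the integral for `Op(a) v_t`, conjugation by the
plane wave shifts the frequency by `t η`, so homogeneity, dominated convergence and Fourier
inversion give `e^{-i t y·η} Op(a) v_t ∼ t^k a_k(y, η) c(y)` pointwise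
(`IsClassicalSymbol.tendsto_Op`). Likewise `(1 + Δ)^j v_t` is `e^{i t y·η}` times a polynomial in
`t` with leading term `t^{2j} |η|_g^{2j} c` (`isOscillating_iterate`).

The difficulty is the norm of `H^k` for real `k`, which is defined by spectral data. Only an upper
bound for it is needed, and only on the functions `u_t = (1 + Δ)^m v_t`. If `k + 2m = 2Nθ` with `0 ≤
θ ≤ 1`, then Hölder's inequality for the sum over eigenvalues together with Bessel's inequality
gives `‖u_t‖_{H^k} ≤ ‖v_t‖^{1-θ} ‖(1 + Δ)^N v_t‖^θ` (`sobolevNorm_iterate_le`). The right side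
contains only `L²`-norms of explicit functions. Neither completeness of the eigenfunctions nor a
calculus of complex powers enters. The auxiliary power `m` makes `k + 2m` nonnegative even when `k <
0`.

Inserting `u_t` into `‖A u‖ ≤ C ‖u‖_{H^k}`, multiplying by `t^{-(k+2m)}` and using Fatou's lemma on
the left yields `‖σ |η|^{2m} c‖ ≤ C ‖c‖^{1-θ} ‖|η|^{2N} c‖^θ` where the cutoffs do not vanish, up to
the cutoff factors (`eLpNorm_symbol_le`). Concentrating `c` at a point turns this into `|σ| |η|^{2m}
≤ C |η|^{2Nθ} = C |η|^{k+2m}` (`norm_symbol_le`), which is the claim.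

Two facts tie the intrinsic definitions to coordinates: the supremum of the chart measures restricts
to the given measure on each chart (`vol_restrict_source`), and the divergence formula satisfies the
weak definition of `Δ` by Green's formula (`isLaplacian_extend`). -/

noncomputable section

namespace PsiDO

/-! ### Gram matrices -/

section Gram

variable {n : ℕ}

/-- The standard basis of `ℝⁿ`. -/
abbrev stdVec (i : Fin n) : Rn n := EuclideanSpace.single i (1 : ℝ)

theorem sum_coord_smul_stdVec (v : Rn n) : ∑ k, v k • stdVec k = v := by
  ext i
  simp [stdVec, Finset.sum_apply, Pi.single_apply]

/-- The matrix of an endomorphism of `ℝⁿ` in the standard basis. -/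
def stdMatrix (L : Rn n →L[ℝ] Rn n) : Matrix (Fin n) (Fin n) ℝ :=
  Matrix.of fun i j => L (stdVec j) i

theorem apply_stdVec_eq_sum {E : Type*} [AddCommGroup E] [Module ℝ E] (f : Rn n →ₗ[ℝ] E)
    (L : Rn n →L[ℝ] Rn n) (i : Fin n) :
    f (L (stdVec i)) = ∑ k, stdMatrix L k i • f (stdVec k) := by
  conv_lhs => rw [← sum_coord_smul_stdVec (L (stdVec i))]
  simp [stdMatrix]

theorem stdMatrix_comp (T L : Rn n →L[ℝ] Rn n) :
    stdMatrix (T.comp L) = stdMatrix T * stdMatrix L := by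
  ext i j
  have h := congrArg (fun v : Rn n => v i) (apply_stdVec_eq_sum (T : Rn n →ₗ[ℝ] Rn n) L j)
  simp only [ContinuousLinearMap.coe_coe, PiLp.smul_apply, WithLp.ofLp_sum, Finset.sum_apply,
    smul_eq_mul] at h
  simp only [Matrix.mul_apply, stdMatrix, Matrix.of_apply, ContinuousLinearMap.comp_apply] at h ⊢
  rw [h]
  exact Finset.sum_congr rfl fun k _ => by simp [mul_comm]

theorem stdMatrix_id : stdMatrix (ContinuousLinearMap.id ℝ (Rn n)) = 1 := by
  ext i j
  simp [stdMatrix, Matrix.one_apply]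

theorem det_stdMatrix (L : Rn n →L[ℝ] Rn n) : (stdMatrix L).det = L.det := by
  have h : stdMatrix L = LinearMap.toMatrix (EuclideanSpace.basisFun (Fin n) ℝ).toBasis
      (EuclideanSpace.basisFun (Fin n) ℝ).toBasis (L : Rn n →ₗ[ℝ] Rn n) := by
    ext i j
    simp [stdMatrix, LinearMap.toMatrix_apply]
  rw [h, LinearMap.det_toMatrix]

/-- The Gram matrix of a bilinear form in the images of the standard basis. -/
def gramMatrix (B : Rn n →L[ℝ] Rn n →L[ℝ] ℝ) (T : Rn n →L[ℝ] Rn n) : Matrix (Fin n) (Fin n) ℝ :=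
  Matrix.of fun i j => B (T (stdVec i)) (T (stdVec j))

theorem gramMatrix_comp (B : Rn n →L[ℝ] Rn n →L[ℝ] ℝ) (T L : Rn n →L[ℝ] Rn n) :
    gramMatrix B (T.comp L) = (stdMatrix L).transpose * gramMatrix B T * stdMatrix L := by
  ext i j
  have h1 : ∀ w, B (T (L (stdVec i))) w = ∑ k, stdMatrix L k i * B (T (stdVec k)) w := fun w => by
    have := apply_stdVec_eq_sum (((ContinuousLinearMap.apply ℝ ℝ w).comp (B.comp T) :
      Rn n →L[ℝ] ℝ) : Rn n →ₗ[ℝ] ℝ) L i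
    simpa using this
  have h2 : ∀ w, B w (T (L (stdVec j))) = ∑ k, stdMatrix L k j * B w (T (stdVec k)) := fun w => by
    have := apply_stdVec_eq_sum (((B w).comp T : Rn n →L[ℝ] ℝ) : Rn n →ₗ[ℝ] ℝ) L j
    simpa using this
  simp only [gramMatrix, Matrix.of_apply, ContinuousLinearMap.comp_apply, Matrix.mul_apply,
    Matrix.transpose_apply]
  rw [h2]
  refine Finset.sum_congr rfl fun k _ => ?_
  rw [h1, mul_comm]

theorem det_gramMatrix_comp (B : Rn n →L[ℝ] Rn n →L[ℝ] ℝ) (T L : Rn n →L[ℝ] Rn n) :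
    (gramMatrix B (T.comp L)).det = L.det ^ 2 * (gramMatrix B T).det := by
  rw [gramMatrix_comp, Matrix.det_mul, Matrix.det_mul, Matrix.det_transpose, det_stdMatrix]
  ring

theorem gramMatrix_quadratic (B : Rn n →L[ℝ] Rn n →L[ℝ] ℝ) (T : Rn n →L[ℝ] Rn n)
    (v : Fin n → ℝ) :
    v ⬝ᵥ (gramMatrix B T).mulVec v =
      B (T (∑ i, v i • stdVec i)) (T (∑ i, v i • stdVec i)) := by
  simp only [dotProduct, Matrix.mulVec, gramMatrix, Matrix.of_apply, map_sum, map_smul,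
    sum_apply, smul_apply, smul_eq_mul, Finset.mul_sum]
  rw [Finset.sum_comm]
  refine Finset.sum_congr rfl fun i _ => Finset.sum_congr rfl fun j _ => by ring

theorem posDef_gramMatrix {B : Rn n →L[ℝ] Rn n →L[ℝ] ℝ} {T : Rn n →L[ℝ] Rn n}
    (hs : ∀ v w, B v w = B w v) (hp : ∀ v, v ≠ 0 → 0 < B v v) (hT : Function.Injective T) :
    (gramMatrix B T).PosDef := by
  refine Matrix.PosDef.of_dotProduct_mulVec_pos ?_ fun v hv => ?_
  · ext i j
    simp [gramMatrix, hs (T (stdVec j))]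
  · simp only [star_trivial]
    rw [gramMatrix_quadratic]
    refine hp _ fun h => hv ?_
    have h2 := hT (h.trans (map_zero T).symm)
    ext i
    have h3 := congrArg (fun w : Rn n => w i) h2
    simpa [Finset.sum_apply, Pi.single_apply] using h3

/-- The pairing of covectors does not depend on the basis in which it is computed. -/
theorem sum_inv_gramMatrix_comp {F : Type*} [RCLike F] {B : Rn n →L[ℝ] Rn n →L[ℝ] ℝ}
    {T L S : Rn n →L[ℝ] Rn n} (hSL : S.comp L = ContinuousLinearMap.id ℝ (Rn n))
    (hLS : L.comp S = ContinuousLinearMap.id ℝ (Rn n)) (α β : Rn n →L[ℝ] F) :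
    ∑ i, ∑ j, ((gramMatrix B (T.comp L))⁻¹ i j) • (α (L (stdVec i)) * β (L (stdVec j))) =
      ∑ i, ∑ j, ((gramMatrix B T)⁻¹ i j) • (α (stdVec i) * β (stdVec j)) := by
  have h1 : stdMatrix L * stdMatrix S = 1 := by rw [← stdMatrix_comp, hLS, stdMatrix_id]
  have h2 : stdMatrix S * stdMatrix L = 1 := by rw [← stdMatrix_comp, hSL, stdMatrix_id]
  have hinv : (stdMatrix L)⁻¹ = stdMatrix S := Matrix.inv_eq_left_inv h2
  -- The Gram matrix transforms by `G ↦ Lᵀ G L`, hence its inverse contravariantly; this cancels the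
  -- covariant change of the two covectors.
  have h3 : stdMatrix L * (gramMatrix B (T.comp L))⁻¹ * (stdMatrix L).transpose =
      (gramMatrix B T)⁻¹ := by
    rw [gramMatrix_comp, Matrix.mul_inv_rev, Matrix.mul_inv_rev, hinv, ← Matrix.mul_assoc, h1,
      Matrix.one_mul, Matrix.mul_assoc, ← Matrix.transpose_nonsing_inv, hinv,
      ← Matrix.transpose_mul, h1, Matrix.transpose_one, Matrix.mul_one]
  rw [← h3]
  have ha : ∀ i, α (L (stdVec i)) = ∑ k, stdMatrix L k i • α (stdVec k) :=
    fun i => apply_stdVec_eq_sum (α : Rn n →ₗ[ℝ] F) L i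
  have hb : ∀ i, β (L (stdVec i)) = ∑ k, stdMatrix L k i • β (stdVec k) :=
    fun i => apply_stdVec_eq_sum (β : Rn n →ₗ[ℝ] F) L i
  have hcomm : ∀ t : Fin n → Fin n → Fin n → Fin n → F,
      ∑ i, ∑ j, ∑ k, ∑ l, t i j k l = ∑ k, ∑ l, ∑ j, ∑ i, t i j k l := fun t => by
    rw [Finset.sum_comm, Finset.sum_congr rfl fun j _ => Finset.sum_comm, Finset.sum_comm]
    refine Finset.sum_congr rfl fun k _ => ?_
    rw [Finset.sum_congr rfl fun j _ => Finset.sum_comm, Finset.sum_comm]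
  have hL : ∀ i j, ((gramMatrix B (T.comp L))⁻¹ i j) • (α (L (stdVec i)) * β (L (stdVec j))) =
      ∑ k, ∑ l, (stdMatrix L k i * (gramMatrix B (T.comp L))⁻¹ i j * stdMatrix L l j) •
        (α (stdVec k) * β (stdVec l)) := fun i j => by
    rw [ha, hb, Finset.sum_mul_sum, Finset.smul_sum]
    refine Finset.sum_congr rfl fun k _ => ?_
    rw [Finset.smul_sum]
    refine Finset.sum_congr rfl fun l _ => ?_
    rw [smul_mul_smul_comm, smul_smul]
    congr 1
    ring
  simp only [hL]
  rw [hcomm]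
  refine Finset.sum_congr rfl fun k _ => Finset.sum_congr rfl fun l _ => ?_
  simp only [Matrix.mul_apply, Matrix.transpose_apply, Finset.sum_mul, Finset.sum_smul]

end Gram

/-! ### The metric in a chart -/

section ChartMetric

variable {n : ℕ} {M : Type*} [TopologicalSpace M] [ChartedSpace (Rn n) M]

theorem mdifferentiable_of_mem_charts {κ : OpenPartialHomeomorph M (Rn n)} (hκ : κ ∈ Charts n M) :
    κ.MDifferentiable (𝓡 n) (𝓡 n) :=
  ⟨(contMDiffOn_of_mem_maximalAtlas hκ).mdifferentiableOn (by simp),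
    (contMDiffOn_symm_of_mem_maximalAtlas hκ).mdifferentiableOn (by simp)⟩

theorem contDiffOn_transition {κ κ' : OpenPartialHomeomorph M (Rn n)}
    (hκ : κ ∈ Charts n M) (hκ' : κ' ∈ Charts n M) :
    ContDiffOn ℝ ∞ (fun z => κ' (κ.symm z)) (κ.target ∩ κ.symm ⁻¹' κ'.source) := by
  rw [← contMDiffOn_iff_contDiffOn]
  exact (contMDiffOn_of_mem_maximalAtlas hκ').comp
    ((contMDiffOn_symm_of_mem_maximalAtlas hκ).mono Set.inter_subset_left) fun z hz => hz.2

variable [IsManifold (𝓡 n) ∞ M]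

theorem chartGram_eq_gramMatrix (g : Metric n M) (κ : OpenPartialHomeomorph M (Rn n)) (y : Rn n) :
    chartGram g κ y = gramMatrix (g.inner (κ.symm y)) (mfderiv (𝓡 n) (𝓡 n) κ.symm y) := rfl

theorem posDef_chartGram (g : Metric n M) {κ : OpenPartialHomeomorph M (Rn n)}
    (hκ : κ ∈ Charts n M) {y : Rn n} (hy : y ∈ κ.target) : (chartGram g κ y).PosDef := by
  rw [chartGram_eq_gramMatrix]
  refine posDef_gramMatrix (g.symm _) (g.pos _) ?_
  exact (mdifferentiable_of_mem_charts hκ).symm.mfderiv_injective hy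

theorem det_chartGram_pos (g : Metric n M) {κ : OpenPartialHomeomorph M (Rn n)}
    (hκ : κ ∈ Charts n M) {y : Rn n} (hy : y ∈ κ.target) : 0 < (chartGram g κ y).det :=
  (posDef_chartGram g hκ hy).det_pos

/-- The coordinate fields are smooth along `κ.symm`, being the tangent map of `κ.symm` on constant
fields, and `g` is a smooth section of bilinear forms. -/
theorem contDiffOn_chartGram (g : Metric n M) {κ : OpenPartialHomeomorph M (Rn n)}
    (hκ : κ ∈ Charts n M) (i j : Fin n) :
    ContDiffOn ℝ ∞ (fun y => chartGram g κ y i j) κ.target := by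
  have hsec : ∀ i : Fin n, ContMDiffOn (𝓡 n) ((𝓡 n).prod (𝓡 n)) ∞
      (fun y : Rn n => (⟨κ.symm y, mfderiv (𝓡 n) (𝓡 n) κ.symm y (stdVec i)⟩ :
        TangentBundle (𝓡 n) M)) κ.target := fun i => by
    have h1 := (contMDiffOn_symm_of_mem_maximalAtlas hκ).contMDiffOn_tangentMapWithin
      (m := ∞) (by simp) κ.open_target.uniqueMDiffOn
    have h2 : ContMDiff (𝓡 n) ((𝓡 n).prod (𝓡 n)) ∞
        (fun y : Rn n => (⟨y, stdVec i⟩ : TangentBundle (𝓡 n) (Rn n))) :=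
      contMDiff_vectorSpace_iff_contDiff.2 contDiff_const
    have h3 := h1.comp (h2.contMDiffOn (s := κ.target)) (fun y hy => hy)
    refine h3.congr fun y hy => ?_
    simp only [Function.comp, tangentMapWithin]
    rw [mfderivWithin_of_isOpen κ.open_target hy]
  rw [← contMDiffOn_iff_contDiffOn]
  intro y hy
  have hg := g.contMDiff.contMDiffAt.comp_contMDiffWithinAt y
    ((contMDiffOn_symm_of_mem_maximalAtlas hκ) y hy)
  have := ContMDiffWithinAt.clm_bundle_apply₂ (E₃ := Bundle.Trivial M ℝ) (F₃ := ℝ)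
    hg (hsec i y hy) (hsec j y hy)
  simp only [Bundle.contMDiffWithinAt_totalSpace] at this
  exact this.2

/-- The pairing of covectors in terms of a chart. -/
theorem cometric_eq_chart {F : Type*} [RCLike F] (g : Metric n M)
    {κ : OpenPartialHomeomorph M (Rn n)} (hκ : κ ∈ Charts n M) {y : Rn n} (hy : y ∈ κ.target)
    (α β : TangentSpace (𝓡 n) (κ.symm y) →L[ℝ] F) :
    cometric g (κ.symm y) α β =
      ∑ i, ∑ j, ((chartGram g κ y)⁻¹ i j) •
        (α (mfderiv (𝓡 n) (𝓡 n) κ.symm y (stdVec i)) *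
          β (mfderiv (𝓡 n) (𝓡 n) κ.symm y (stdVec j))) := by
  have hd := mdifferentiable_of_mem_charts hκ
  have h1 := hd.symm_comp_deriv (κ.map_target hy)
  rw [κ.right_inv hy] at h1
  have h2 := hd.comp_symm_deriv hy
  -- `tangentBasis` is the standard basis of the model fibre, so `T` is the identity and `L` is the
  -- passage to the coordinate frame.
  exact (sum_inv_gramMatrix_comp (n := n) (B := g.inner (κ.symm y))
    (T := ContinuousLinearMap.id ℝ (Rn n)) (L := mfderiv (𝓡 n) (𝓡 n) κ.symm y)
    (S := mfderiv (𝓡 n) (𝓡 n) κ (κ.symm y)) h2 h1 α β).symm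

theorem cometric_comm {F : Type*} [RCLike F] (g : Metric n M) (x : M)
    (α β : TangentSpace (𝓡 n) x →L[ℝ] F) : cometric g x α β = cometric g x β α := by
  have hG : (gram g x).transpose = gram g x := by
    ext i j
    exact g.symm _ _ _
  have hI : ∀ i j, (gram g x)⁻¹ i j = (gram g x)⁻¹ j i := fun i j => by
    conv_lhs => rw [← hG, ← Matrix.transpose_nonsing_inv]
    rfl
  unfold cometric
  rw [Finset.sum_comm]
  refine Finset.sum_congr rfl fun j _ => Finset.sum_congr rfl fun i _ => ?_
  rw [hI, mul_comm]

/-- The Gram determinants of two charts. -/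
theorem det_chartGram_eq (g : Metric n M) {κ κ' : OpenPartialHomeomorph M (Rn n)}
    (hκ : κ ∈ Charts n M) (hκ' : κ' ∈ Charts n M) {y : Rn n} (hy : y ∈ κ.target)
    (hy' : κ.symm y ∈ κ'.source) :
    (chartGram g κ y).det =
      (fderiv ℝ (fun z => κ' (κ.symm z)) y).det ^ 2 * (chartGram g κ' (κ' (κ.symm y))).det := by
  have hd := mdifferentiable_of_mem_charts hκ
  have hd' := mdifferentiable_of_mem_charts hκ'
  have hleft : κ'.symm (κ' (κ.symm y)) = κ.symm y := κ'.left_inv hy'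
  have hτ : MDifferentiableAt (𝓡 n) (𝓡 n) (κ' ∘ κ.symm) y :=
    (hd'.mdifferentiableAt hy').comp y (hd.mdifferentiableAt_symm hy)
  have hev : κ.symm =ᶠ[nhds y] κ'.symm ∘ (κ' ∘ κ.symm) := by
    filter_upwards [(κ.symm.continuousAt hy).preimage_mem_nhds (κ'.open_source.mem_nhds hy')]
      with z hz
    exact (κ'.left_inv hz).symm
  have hcomp : mfderiv (𝓡 n) (𝓡 n) κ.symm y =
      (mfderiv (𝓡 n) (𝓡 n) κ'.symm (κ' (κ.symm y))).comp
        (mfderiv (𝓡 n) (𝓡 n) (κ' ∘ κ.symm) y) := by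
    rw [hev.mfderiv_eq]
    exact mfderiv_comp y (hd'.mdifferentiableAt_symm (κ'.map_source hy')) hτ
  have hfd : mfderiv (𝓡 n) (𝓡 n) (κ' ∘ κ.symm) y = fderiv ℝ (fun z => κ' (κ.symm z)) y :=
    mfderiv_eq_fderiv
  have key := det_gramMatrix_comp (n := n) (g.inner (κ.symm y))
    (mfderiv (𝓡 n) (𝓡 n) κ'.symm (κ' (κ.symm y))) (fderiv ℝ (fun z => κ' (κ.symm z)) y)
  have hB : chartGram g κ' (κ' (κ.symm y)) = gramMatrix (n := n) (g.inner (κ.symm y))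
    (mfderiv (𝓡 n) (𝓡 n) κ'.symm (κ' (κ.symm y))) := by
    ext i j
    change g.inner (κ'.symm (κ' (κ.symm y))) _ _ = g.inner (κ.symm y) _ _
    rw [hleft]
    rfl
  rw [hB, ← key, chartGram_eq_gramMatrix, hcomp, hfd]
  rfl

end ChartMetric

/-! ### The Riemannian volume in a chart -/

section Volume

open MeasureTheory

/-- Inverse charts are continuous only on their targets, so measurability of preimages has to be
taken relative to the target. -/
theorem measurableSet_inter_preimage_of_continuousOn {X Y : Type*} [TopologicalSpace X]
    [MeasurableSpace X] [OpensMeasurableSpace X] [TopologicalSpace Y] [MeasurableSpace Y]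
    [BorelSpace Y] {f : X → Y} {s : Set X} (hf : ContinuousOn f s) (hs : MeasurableSet s)
    {E : Set Y} (hE : MeasurableSet E) : MeasurableSet (s ∩ f ⁻¹' E) := by
  have h : MeasurableSet (s.domRestrict f ⁻¹' E) :=
    (continuousOn_iff_continuous_domRestrict.1 hf).measurable hE
  have h2 := hs.subtype_image h
  rwa [Set.domRestrict_eq, Set.preimage_comp, Subtype.image_preimage_coe] at h2

theorem aemeasurable_chart_symm {n : ℕ} {M : Type*} [TopologicalSpace M] [MeasurableSpace M]
    [BorelSpace M] (κ : OpenPartialHomeomorph M (Rn n)) (f : Rn n → ℝ≥0∞) :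
    AEMeasurable κ.symm (((volume : Measure (Rn n)).restrict κ.target).withDensity f) :=
  (κ.continuousOn_symm.aemeasurable κ.open_target.measurableSet).mono_ac
    (withDensity_absolutelyContinuous _ _)

theorem contDiffOn_det {n : ℕ} {G : Rn n → Matrix (Fin n) (Fin n) ℝ} {s : Set (Rn n)}
    (hG : ∀ i j, ContDiffOn ℝ ∞ (fun y => G y i j) s) :
    ContDiffOn ℝ ∞ (fun y => (G y).det) s := by
  simp only [Matrix.det_apply]
  exact ContDiffOn.sum fun σ _ => ContDiffOn.const_smul _ (contDiffOn_prod fun i _ => hG _ _)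

variable {n : ℕ} {M : Type*} [TopologicalSpace M] [ChartedSpace (Rn n) M] [IsManifold (𝓡 n) ∞ M]

/-- The volume density `√(det g_{ij})` in a chart. -/
def density (g : Metric n M) (κ : OpenPartialHomeomorph M (Rn n)) (y : Rn n) : ℝ :=
  Real.sqrt (chartGram g κ y).det

theorem density_pos (g : Metric n M) {κ : OpenPartialHomeomorph M (Rn n)}
    (hκ : κ ∈ Charts n M) {y : Rn n} (hy : y ∈ κ.target) : 0 < density g κ y :=
  Real.sqrt_pos.2 (det_chartGram_pos g hκ hy)

theorem contDiffOn_density (g : Metric n M) {κ : OpenPartialHomeomorph M (Rn n)}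
    (hκ : κ ∈ Charts n M) : ContDiffOn ℝ ∞ (density g κ) κ.target :=
  (contDiffOn_det (contDiffOn_chartGram g hκ)).sqrt fun _ hy => (det_chartGram_pos g hκ hy).ne'

theorem density_eq (g : Metric n M) {κ κ' : OpenPartialHomeomorph M (Rn n)}
    (hκ : κ ∈ Charts n M) (hκ' : κ' ∈ Charts n M) {y : Rn n} (hy : y ∈ κ.target)
    (hy' : κ.symm y ∈ κ'.source) :
    density g κ y =
      |(fderiv ℝ (fun z => κ' (κ.symm z)) y).det| * density g κ' (κ' (κ.symm y)) := by
  rw [density, det_chartGram_eq g hκ hκ' hy hy', Real.sqrt_mul (sq_nonneg _), Real.sqrt_sq_eq_abs]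
  rfl

theorem aemeasurable_density (g : Metric n M) {κ : OpenPartialHomeomorph M (Rn n)}
    (hκ : κ ∈ Charts n M) :
    AEMeasurable (density g κ) ((volume : Measure (Rn n)).restrict κ.target) :=
  (contDiffOn_density g hκ).continuousOn.aemeasurable κ.open_target.measurableSet

variable [MeasurableSpace M] [BorelSpace M]

theorem lintegral_chartVolume (g : Metric n M) {κ : OpenPartialHomeomorph M (Rn n)}
    (hκ : κ ∈ Charts n M) {F : M → ℝ≥0∞} (hF : Measurable F) :
    ∫⁻ x, F x ∂(chartVolume g κ) =
      ∫⁻ y in κ.target, ENNReal.ofReal (density g κ y) * F (κ.symm y) := by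
  unfold chartVolume
  rw [lintegral_map' hF.aemeasurable (aemeasurable_chart_symm κ _)]
  exact lintegral_withDensity_eq_lintegral_mul₀ (aemeasurable_density g hκ).ennreal_ofReal
    (hF.comp_aemeasurable (κ.continuousOn_symm.aemeasurable κ.open_target.measurableSet))

theorem chartVolume_apply (g : Metric n M) {κ : OpenPartialHomeomorph M (Rn n)}
    (hκ : κ ∈ Charts n M) {E : Set M} (hE : MeasurableSet E) :
    chartVolume g κ E =
      ∫⁻ y in κ.target ∩ κ.symm ⁻¹' E, ENNReal.ofReal (density g κ y) := by
  have hm := measurableSet_inter_preimage_of_continuousOn κ.continuousOn_symm κ.open_target.measurableSet hE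
  rw [← lintegral_indicator_one hE, lintegral_chartVolume g hκ (measurable_one.indicator hE),
    ← lintegral_indicator hm, ← lintegral_indicator κ.open_target.measurableSet]
  refine lintegral_congr fun y => ?_
  by_cases h1 : y ∈ κ.target <;> by_cases h2 : κ.symm y ∈ E <;> simp [h1, h2]

theorem chartVolume_compl_source (g : Metric n M) {κ : OpenPartialHomeomorph M (Rn n)}
    (hκ : κ ∈ Charts n M) : chartVolume g κ κ.sourceᶜ = 0 := by
  rw [chartVolume_apply g hκ κ.open_source.measurableSet.compl]
  have : κ.target ∩ κ.symm ⁻¹' κ.sourceᶜ = ∅ := by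
    ext y
    simp only [Set.mem_inter_iff, Set.mem_preimage, Set.mem_compl_iff, Set.mem_empty_iff_false,
      iff_false, not_and, not_not]
    exact fun hy => κ.map_target hy
  rw [this, Measure.restrict_empty, lintegral_zero_measure]

/-- The volumes of two charts agree on the intersection of their domains. -/
theorem chartVolume_eq_of_subset (g : Metric n M) {κ κ' : OpenPartialHomeomorph M (Rn n)}
    (hκ : κ ∈ Charts n M) (hκ' : κ' ∈ Charts n M) {E : Set M} (hE : MeasurableSet E)
    (hs : E ⊆ κ.source) (hs' : E ⊆ κ'.source) : chartVolume g κ' E = chartVolume g κ E := by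
  rw [chartVolume_apply g hκ hE, chartVolume_apply g hκ' hE]
  have hm := measurableSet_inter_preimage_of_continuousOn κ.continuousOn_symm κ.open_target.measurableSet hE
  have himg : κ'.target ∩ κ'.symm ⁻¹' E =
      (fun z => κ' (κ.symm z)) '' (κ.target ∩ κ.symm ⁻¹' E) := by
    ext y
    constructor
    · rintro ⟨hy, hyE⟩
      refine ⟨κ (κ'.symm y), ⟨κ.map_source (hs hyE), ?_⟩, ?_⟩
      · simpa [κ.left_inv (hs hyE)] using hyE
      · simp [κ.left_inv (hs hyE), κ'.right_inv hy]
    · rintro ⟨z, ⟨hz, hzE⟩, rfl⟩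
      refine ⟨κ'.map_source (hs' hzE), ?_⟩
      simpa [κ'.left_inv (hs' hzE)] using hzE
  have hopen : IsOpen (κ.target ∩ κ.symm ⁻¹' κ'.source) :=
    κ.continuousOn_symm.isOpen_inter_preimage κ.open_target κ'.open_source
  -- Change of variables along the transition map; its Jacobian is exactly the factor relating the
  -- two densities in `density_eq`.
  rw [himg, lintegral_image_eq_lintegral_abs_det_fderiv_mul volume hm
    (f' := fun y => fderiv ℝ (fun z => κ' (κ.symm z)) y) (fun y hy => ?_) ?_]
  · refine setLIntegral_congr_fun hm fun y hy => ?_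
    rw [density_eq g hκ hκ' hy.1 (hs' hy.2), ENNReal.ofReal_mul (abs_nonneg _)]
  · intro y hy z hz h
    have h2 := κ'.injOn (hs' hy.2) (hs' hz.2) h
    exact κ.symm.injOn hy.1 hz.1 h2
  · have hc := (contDiffOn_transition hκ hκ').contDiffAt (hopen.mem_nhds ⟨hy.1, hs' hy.2⟩)
    exact (hc.differentiableAt (by simp)).hasFDerivAt.hasFDerivWithinAt

/-- A supremum of measures is hard to evaluate but easy to bound: `chartVolume g κ` plus the part of
`vol g` off the domain of `κ` dominates every chart measure, hence their supremum. -/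
theorem vol_restrict_source (g : Metric n M) {κ : OpenPartialHomeomorph M (Rn n)}
    (hκ : κ ∈ Charts n M) : (vol g).restrict κ.source = chartVolume g κ := by
  have hle : ∀ κ' ∈ Charts n M, chartVolume g κ' ≤ vol g := fun κ' hκ' =>
    le_iSup₂ (f := fun κ (_ : κ ∈ Charts n M) => chartVolume g κ) κ' hκ'
  have hms := κ.open_source.measurableSet
  have hub : vol g ≤ chartVolume g κ + (vol g).restrict κ.sourceᶜ := by
    refine iSup₂_le fun κ' hκ' => Measure.le_iff.2 fun E hE => ?_
    rw [← measure_inter_add_sdiff E hms, Measure.add_apply, Measure.restrict_apply hE]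
    refine add_le_add ?_ (hle κ' hκ' _)
    have hms' := κ'.open_source.measurableSet
    rw [← measure_inter_add_sdiff (E ∩ κ.source) hms',
      chartVolume_eq_of_subset g hκ hκ' ((hE.inter hms).inter hms') (fun x hx => hx.1.2)
        (fun x hx => hx.2),
      measure_mono_null (t := κ'.sourceᶜ) (fun x hx => hx.2) (chartVolume_compl_source g hκ'),
      add_zero]
    exact measure_mono fun x hx => hx.1.1
  refine Measure.ext fun E hE => ?_
  rw [Measure.restrict_apply hE]
  refine le_antisymm ?_ ?_
  · refine (hub _).trans ?_
    rw [Measure.add_apply, Measure.restrict_apply (hE.inter hms)]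
    simp only [Set.inter_assoc, Set.inter_compl_self, Set.inter_empty, measure_empty, add_zero]
    exact measure_mono Set.inter_subset_left
  · rw [← measure_inter_add_sdiff (μ := chartVolume g κ) E hms,
      measure_mono_null (s := E \ κ.source) (t := κ.sourceᶜ) (fun x hx => hx.2) (chartVolume_compl_source g hκ),
      add_zero]
    exact hle κ hκ _

theorem setIntegral_vol_source (g : Metric n M) {κ : OpenPartialHomeomorph M (Rn n)}
    (hκ : κ ∈ Charts n M) {F : M → ℂ} (hF : ContinuousOn F κ.source) :
    ∫ x in κ.source, F x ∂(vol g) = ∫ y in κ.target, density g κ y • F (κ.symm y) := by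
  have hF' : AEStronglyMeasurable F (chartVolume g κ) := by
    rw [← vol_restrict_source g hκ]
    exact hF.aestronglyMeasurable κ.open_source.measurableSet
  rw [vol_restrict_source g hκ]
  unfold chartVolume at hF' ⊢
  rw [integral_map (aemeasurable_chart_symm κ _) hF',
    integral_withDensity_eq_integral_toReal_smul₀
      (f := fun y => ENNReal.ofReal (Real.sqrt (chartGram g κ y).det))
      (aemeasurable_density g hκ).ennreal_ofReal
      (Filter.Eventually.of_forall fun _ => ENNReal.ofReal_lt_top)]
  refine setIntegral_congr_fun κ.open_target.measurableSet fun y hy => ?_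
  rw [show Real.sqrt (chartGram g κ y).det = density g κ y from rfl,
    ENNReal.toReal_ofReal (density_pos g hκ hy).le]

/-- The density is bounded on a compact coordinate neighbourhood of each point, so the volume is
locally finite, and `M` is compact. -/
theorem isFiniteMeasure_vol [CompactSpace M] (g : Metric n M) : IsFiniteMeasure (vol g) := by
  have : IsLocallyFiniteMeasure (vol g) := by
    refine ⟨fun x => ?_⟩
    have hκ : chartAt (Rn n) x ∈ Charts n M := IsManifold.chart_mem_maximalAtlas x
    have hx := mem_chart_source (Rn n) x
    generalize chartAt (Rn n) x = κ at hκ hx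
    obtain ⟨K, hK, hKn, hKs⟩ := local_compact_nhds (κ.open_target.mem_nhds (κ.map_source hx))
    obtain ⟨K, hKc, hKn, hKs⟩ : ∃ K, IsCompact K ∧ K ∈ nhds (κ x) ∧ K ⊆ κ.target :=
      ⟨K, hKs, hK, hKn⟩
    refine ⟨κ.source ∩ κ ⁻¹' interior K, ?_, ?_⟩
    · exact (κ.continuousOn.isOpen_inter_preimage κ.open_source isOpen_interior).mem_nhds
        ⟨hx, mem_interior_iff_mem_nhds.2 hKn⟩
    · have hm : MeasurableSet (κ.source ∩ κ ⁻¹' interior K) :=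
        (κ.continuousOn.isOpen_inter_preimage κ.open_source isOpen_interior).measurableSet
      have h1 : vol g (κ.source ∩ κ ⁻¹' interior K) =
          chartVolume g κ (κ.source ∩ κ ⁻¹' interior K) := by
        rw [← vol_restrict_source g hκ, Measure.restrict_apply hm]
        congr 1
        ext z
        simp only [Set.mem_inter_iff]
        tauto
      rw [h1, chartVolume_apply g hκ hm]
      obtain ⟨C, hC⟩ := hKc.bddAbove_image ((contDiffOn_density g hκ).continuousOn.mono hKs)
      have hsub : κ.target ∩ κ.symm ⁻¹' (κ.source ∩ κ ⁻¹' interior K) ⊆ K := by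
        rintro y ⟨hy, -, hy2⟩
        simp only [Set.mem_preimage, κ.right_inv hy] at hy2
        exact interior_subset hy2
      refine (lintegral_mono_set hsub).trans_lt ?_
      refine (setLIntegral_mono' hKc.measurableSet (g := fun _ => ENNReal.ofReal C)
        fun y hy => ENNReal.ofReal_le_ofReal (hC (Set.mem_image_of_mem _ hy))).trans_lt ?_
      rw [setLIntegral_const]
      exact ENNReal.mul_lt_top ENNReal.ofReal_lt_top hKc.measure_lt_top
  infer_instance

end Volume

/-! ### Bessel's inequality for the spectral decomposition -/

section Bessel

/-- Bessel's inequality for mutually orthogonal sets of vectors in a Hilbert space. -/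
theorem sum_sq_iSup_enorm_inner_div_le {ι H : Type*} [NormedAddCommGroup H]
    [InnerProductSpace ℂ H] [CompleteSpace H] (S : ι → Set H)
    (hS : Pairwise fun i j => ∀ v ∈ S i, ∀ w ∈ S j, inner ℂ v w = 0) (u : H) (F : Finset ι) :
    ∑ i ∈ F, (⨆ f ∈ S i, ‖inner ℂ f u‖ₑ / ‖f‖ₑ) ^ 2 ≤ ‖u‖ₑ ^ 2 := by
  classical
  -- The double complement is the closed span: it admits an orthogonal projection and stays
  -- orthogonal to the other spans.
  let W : ι → Submodule ℂ H := fun i => (Submodule.span ℂ (S i))ᗮᗮ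
  have hW : Pairwise fun i j => W i ⟂ W j := by
    intro i j hij
    have h1 : Submodule.span ℂ (S i) ≤ (Submodule.span ℂ (S j))ᗮ := by
      rw [← Submodule.isOrtho_iff_le, Submodule.isOrtho_span]
      intro v hv w hw
      exact hS hij v hv w hw
    exact Submodule.orthogonal_le (Submodule.orthogonal_le h1)
  have hfam : OrthogonalFamily ℂ (fun i => W i) fun i => (W i).subtypeₗᵢ :=
    OrthogonalFamily.of_pairwise hW
  let P : ∀ i, W i := fun i => (W i).orthogonalProjectionOnto u
  have hP : ∀ i, inner ℂ (P i : H) u = ((‖(P i : H)‖ ^ 2 : ℝ) : ℂ) := fun i => by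
    have h1 := (W i).starProjection_inner_eq_zero u (P i : H) (P i).2
    rw [inner_sub_left, sub_eq_zero] at h1
    rw [← inner_conj_symm, h1]
    change (starRingEnd ℂ) (inner ℂ (P i : H) (P i : H)) = _
    rw [inner_conj_symm, inner_self_eq_norm_sq_to_K]
    push_cast
    rfl
  have hsum : ∑ i ∈ F, ‖(P i : H)‖ ^ 2 ≤ ‖u‖ ^ 2 := by
    have h1 : ‖∑ i ∈ F, (P i : H)‖ ^ 2 = ∑ i ∈ F, ‖(P i : H)‖ ^ 2 := by
      have := hfam.norm_sum P F
      simpa using this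
    -- With `h1` this says `⟨p, u⟩ = ‖p‖²` for the sum `p` of the projections; Cauchy–Schwarz then
    -- gives `‖p‖ ≤ ‖u‖`.
    have h2 : inner ℂ (∑ i ∈ F, (P i : H)) u = ((∑ i ∈ F, ‖(P i : H)‖ ^ 2 : ℝ) : ℂ) := by
      rw [sum_inner, Finset.sum_congr rfl fun i _ => hP i]
      push_cast
      rfl
    have h3 := norm_inner_le_norm (𝕜 := ℂ) (∑ i ∈ F, (P i : H)) u
    rw [h2, Complex.norm_real, Real.norm_of_nonneg (by positivity), ← h1] at h3
    rw [← h1]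
    have h4 : ‖∑ i ∈ F, (P i : H)‖ ≤ ‖u‖ := by
      by_contra! hlt
      have := norm_nonneg u
      nlinarith
    exact pow_le_pow_left₀ (norm_nonneg _) h4 2
  have hle : ∀ i, (⨆ f ∈ S i, ‖inner ℂ f u‖ₑ / ‖f‖ₑ) ≤ ‖(P i : H)‖ₑ := fun i => by
    refine iSup₂_le fun f hf => ENNReal.div_le_of_le_mul ?_
    have hfW : f ∈ W i := Submodule.le_orthogonal_orthogonal _ (Submodule.subset_span hf)
    have h1 := (W i).starProjection_inner_eq_zero u f hfW
    rw [inner_sub_left, sub_eq_zero] at h1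
    have h2 : inner ℂ f u = inner ℂ f (P i : H) := by
      rw [← inner_conj_symm, h1, inner_conj_symm]
      rfl
    rw [h2, mul_comm, ← ofReal_norm, ← ofReal_norm, ← ofReal_norm,
      ← ENNReal.ofReal_mul (norm_nonneg _)]
    exact ENNReal.ofReal_le_ofReal (norm_inner_le_norm _ _)
  calc ∑ i ∈ F, (⨆ f ∈ S i, ‖inner ℂ f u‖ₑ / ‖f‖ₑ) ^ 2
      ≤ ∑ i ∈ F, ‖(P i : H)‖ₑ ^ 2 := Finset.sum_le_sum fun i _ => pow_le_pow_left₀ (by simp) (hle i) 2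
    _ = ENNReal.ofReal (∑ i ∈ F, ‖(P i : H)‖ ^ 2) := by
        rw [ENNReal.ofReal_sum_of_nonneg fun _ _ => by positivity]
        exact Finset.sum_congr rfl fun i _ => by
          rw [← ofReal_norm, ENNReal.ofReal_pow (norm_nonneg _)]
    _ ≤ ENNReal.ofReal (‖u‖ ^ 2) := ENNReal.ofReal_le_ofReal hsum
    _ = ‖u‖ₑ ^ 2 := by rw [ENNReal.ofReal_pow (norm_nonneg _), ofReal_norm]

end Bessel

/-! ### Eigenfunctions and interpolation of Sobolev norms -/

section Spectral

open MeasureTheory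

variable {n : ℕ} {M : Type*} [TopologicalSpace M] [ChartedSpace (Rn n) M]

theorem continuous_smooth (u : Smooth n M) : Continuous (u : M → ℂ) :=
  ContMDiff.continuous u.2

/-- The complex conjugate of a smooth function. -/
def smoothConj (f : Smooth n M) : Smooth n M :=
  ⟨fun x => starRingEnd ℂ ((f : M → ℂ) x),
    (Complex.conjCLE.contDiff (n := ∞)).contMDiff.comp 
      (show ContMDiff (𝓡 n) 𝓘(ℝ, ℂ) ∞ (f : M → ℂ) from f.2)⟩

theorem mdifferentiableAt_smooth (f : Smooth n M) (x : M) :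
    MDifferentiableAt (𝓡 n) 𝓘(ℝ, ℂ) (f : M → ℂ) x :=
  (show ContMDiff (𝓡 n) 𝓘(ℝ, ℂ) ∞ (f : M → ℂ) from f.2).mdifferentiable (by simp) x

theorem differential_conj (f : Smooth n M) (x : M) (v : TangentSpace (𝓡 n) x) :
    differential (smoothConj f) x v = starRingEnd ℂ (differential f x v) := by
  have h1 : MDifferentiableAt 𝓘(ℝ, ℂ) 𝓘(ℝ, ℂ) Complex.conjCLE ((f : M → ℂ) x) :=
    Complex.conjCLE.differentiableAt.mdifferentiableAt
  have h := mfderiv_comp x h1 (mdifferentiableAt_smooth f x)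
  have h3 : mfderiv 𝓘(ℝ, ℂ) 𝓘(ℝ, ℂ) Complex.conjCLE ((f : M → ℂ) x) =
      (Complex.conjCLE : ℂ →L[ℝ] ℂ) := by
    rw [mfderiv_eq_fderiv]
    exact Complex.conjCLE.fderiv
  rw [h3] at h
  exact congrArg (fun L => L v) h

variable [IsManifold (𝓡 n) ∞ M]

theorem cometric_conj (g : Metric n M) (f h : Smooth n M) (x : M) :
    cometric g x (differential (smoothConj f) x) (differential (smoothConj h) x) =
      starRingEnd ℂ (cometric g x (differential f x) (differential h x)) := by
  simp [cometric, differential_conj, map_sum, Complex.real_smul]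

variable [MeasurableSpace M]

/-- `IsLaplacian` uses the bilinear pairing and `spectralPart` the sesquilinear one. Passing between
them is possible because `g` and `μ` are real. -/
theorem IsEigenfunction.conj {g : Metric n M} {μ : ℝ≥0} {f : Smooth n M}
    (hf : IsEigenfunction g μ f) : IsEigenfunction g μ (smoothConj f) := by
  intro h
  have h1 := congrArg (starRingEnd ℂ) (hf (smoothConj h))
  rw [← integral_conj, ← integral_conj] at h1
  simp only [← cometric_conj] at h1
  have h2 : smoothConj (smoothConj h) = h := by
    ext x
    simp [smoothConj]
  rw [h2] at h1
  rw [h1]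
  refine integral_congr_ae (Filter.Eventually.of_forall fun x => ?_)
  simp [smoothConj]

/-- `⟨Δ u, f⟩ = μ ⟨u, f⟩` for an eigenfunction `f`. -/
theorem IsLaplacian.integral_mul_conj {g : Metric n M} {u w f : Smooth n M} {μ : ℝ≥0}
    (hw : IsLaplacian g u w) (hf : IsEigenfunction g μ f) :
    ∫ x, (w : M → ℂ) x * starRingEnd ℂ ((f : M → ℂ) x) ∂(vol g) =
      ((μ : ℝ) : ℂ) * ∫ x, (u : M → ℂ) x * starRingEnd ℂ ((f : M → ℂ) x) ∂(vol g) := by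
  -- The equation for `u` is tested with the conjugate of `f`, the one for the conjugate of `f` with
  -- `u`; both left sides are the same symmetric Dirichlet form.
  have h1 := hw (smoothConj f)
  have h2 := hf.conj u
  simp only [cometric_comm g _ (differential u _)] at h1
  rw [h2] at h1
  refine h1.symm.trans ?_
  rw [← integral_const_mul]
  refine integral_congr_ae (Filter.Eventually.of_forall fun x => ?_)
  simp only [smoothConj, Submodule.coe_smul, Pi.smul_apply, smul_eq_mul]
  ring

theorem IsEigenfunction.integral_mul_conj_eq_zero {g : Metric n M} {f f' : Smooth n M} {μ ν : ℝ≥0}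
    (hf : IsEigenfunction g μ f) (hf' : IsEigenfunction g ν f') (hne : μ ≠ ν) :
    ∫ x, (f : M → ℂ) x * starRingEnd ℂ ((f' : M → ℂ) x) ∂(vol g) = 0 := by
  have h := IsLaplacian.integral_mul_conj hf hf'
  have h2 : ∫ x, ((((μ : ℝ) : ℂ) • f : Smooth n M) : M → ℂ) x *
      starRingEnd ℂ ((f' : M → ℂ) x) ∂(vol g) =
      ((μ : ℝ) : ℂ) * ∫ x, (f : M → ℂ) x * starRingEnd ℂ ((f' : M → ℂ) x) ∂(vol g) := by
    rw [← integral_const_mul]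
    refine integral_congr_ae (Filter.Eventually.of_forall fun x => ?_)
    simp [mul_assoc]
  rw [h2] at h
  by_contra h0
  have h3 := mul_right_cancel₀ h0 h
  exact hne (by exact_mod_cast h3)

variable [BorelSpace M] [CompactSpace M]

theorem memLp_smooth (g : Metric n M) (u : Smooth n M) (p : ℝ≥0∞) :
    MemLp (u : M → ℂ) p (vol g) := by
  have := isFiniteMeasure_vol g
  obtain ⟨C, hC⟩ := (isCompact_range (continuous_smooth u).norm).bddAbove
  exact MemLp.of_bound (continuous_smooth u).aestronglyMeasurable C
    (Filter.Eventually.of_forall fun x => hC ⟨x, rfl⟩)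

theorem l2Norm_ne_top (g : Metric n M) (u : Smooth n M) : l2Norm g u ≠ ⊤ := (memLp_smooth g u 2).2.ne

/-- A smooth function as an element of `L²`. -/
def toL2 (g : Metric n M) (u : Smooth n M) : Lp ℂ 2 (vol g) := (memLp_smooth g u 2).toLp

theorem enorm_toL2 (g : Metric n M) (u : Smooth n M) : ‖toL2 g u‖ₑ = l2Norm g u :=
  Lp.enorm_toLp _

theorem inner_toL2 (g : Metric n M) (f u : Smooth n M) :
    inner ℂ (toL2 g f) (toL2 g u) =
      ∫ x, (u : M → ℂ) x * starRingEnd ℂ ((f : M → ℂ) x) ∂(vol g) := by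
  rw [L2.inner_def]
  refine integral_congr_ae ?_
  filter_upwards [(memLp_smooth g f 2).coeFn_toLp, (memLp_smooth g u 2).coeFn_toLp] with x h1 h2
  rw [toL2, toL2, h1, h2]
  simp

/-- Bessel applied to the mutually orthogonal eigenspaces, over finite sets of eigenvalues. Equality
would require completeness of the eigenfunctions, but an upper bound is all that interpolation uses.
-/
theorem tsum_spectralPart_sq_le (g : Metric n M) (u : Smooth n M) :
    ∑' μ, spectralPart g μ u ^ 2 ≤ l2Norm g u ^ 2 := by
  rw [ENNReal.tsum_eq_iSup_sum]
  refine iSup_le fun F => ?_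
  have h := sum_sq_iSup_enorm_inner_div_le
    (fun μ : ℝ≥0 => (fun f : Smooth n M => toL2 g f) '' {f | IsEigenfunction g μ f})
    (fun μ ν hne => by
      rintro _ ⟨f, hf, rfl⟩ _ ⟨f', hf', rfl⟩
      rw [inner_toL2]
      exact IsEigenfunction.integral_mul_conj_eq_zero hf' hf hne.symm) (toL2 g u) F
  simp only [iSup_image, enorm_toL2, inner_toL2] at h
  exact h

theorem integrable_mul_conj (g : Metric n M) (u f : Smooth n M) :
    Integrable (fun x => (u : M → ℂ) x * starRingEnd ℂ ((f : M → ℂ) x)) (vol g) :=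
  (memLp_smooth g u 2).integrable_mul (memLp_smooth g (smoothConj f) 2)

/-- `P_μ (1 + Δ) u = (1 + μ) P_μ u`. -/
theorem spectralPart_of_isLaplacian {g : Metric n M} {u w : Smooth n M}
    (hw : IsLaplacian g u (w - u)) (μ : ℝ≥0) :
    spectralPart g μ w = (1 + μ) * spectralPart g μ u := by
  unfold spectralPart
  simp only [ENNReal.mul_iSup]
  refine iSup_congr fun f => iSup_congr fun hf => ?_
  have h1 := hw.integral_mul_conj hf
  have h2 : ∫ x, (w : M → ℂ) x * starRingEnd ℂ ((f : M → ℂ) x) ∂(vol g) =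
      (1 + ((μ : ℝ) : ℂ)) *
        ∫ x, (u : M → ℂ) x * starRingEnd ℂ ((f : M → ℂ) x) ∂(vol g) := by
    rw [add_mul, one_mul, ← h1, ← integral_add (integrable_mul_conj g _ _)
      (integrable_mul_conj g _ _)]
    refine integral_congr_ae (Filter.Eventually.of_forall fun x => ?_)
    simp only [Submodule.coe_sub, Pi.sub_apply]
    ring
  have h3 : ‖(1 + ((μ : ℝ) : ℂ))‖ₑ = 1 + (μ : ℝ≥0∞) := by
    have : (1 + ((μ : ℝ) : ℂ)) = (((1 + μ : ℝ≥0) : ℝ) : ℂ) := by push_cast; rfl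
    rw [this, ← ofReal_norm, Complex.norm_real, Real.norm_of_nonneg (NNReal.coe_nonneg _),
      ENNReal.ofReal_coe_nnreal]
    push_cast
    rfl
  rw [h2, enorm_mul, h3, mul_div_assoc]

/-- Since `Δ` is only a relation between smooth functions, its powers are encoded by a sequence:
`hu` says that `u j = (1 + Δ)^j (u 0)`. -/
theorem spectralPart_iterate {g : Metric n M} {u : ℕ → Smooth n M}
    (hu : ∀ j, IsLaplacian g (u j) (u (j + 1) - u j)) (μ : ℝ≥0) (j : ℕ) :
    spectralPart g μ (u j) = (1 + μ) ^ j * spectralPart g μ (u 0) := by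
  induction j with
  | zero => simp
  | succ j ih => rw [spectralPart_of_isLaplacian (hu j), ih, pow_succ]; ring

/-- The interpolation inequality `‖v‖_{H^{s}} ≤ ‖v‖^{1 - θ} ‖(1 + Δ)^N v‖^θ`, `s = 2 N θ`, applied to
`(1 + Δ)^m v`. -/
theorem sobolevNorm_iterate_le {g : Metric n M} {u : ℕ → Smooth n M}
    (hu : ∀ j, IsLaplacian g (u j) (u (j + 1) - u j)) {s θ : ℝ} {m N : ℕ} (h0 : 0 ≤ θ)
    (h1 : θ ≤ 1) (hs : s + 2 * m = 2 * N * θ) :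
    sobolevNorm g s (u m) ≤ l2Norm g (u 0) ^ (1 - θ) * l2Norm g (u N) ^ θ := by
  -- With every set measurable, sums over `μ` are integrals for the counting measure, to which
  -- Hölder's inequality applies.
  let _ : MeasurableSpace ℝ≥0 := ⊤
  -- With `a = 1 + μ` and `S` the spectral part of `u 0`, both sides equal `a^{s+2m} S² = a^{2Nθ}
  -- S²`.
  have hterm : ∀ μ : ℝ≥0, ((1 + (μ : ℝ≥0∞)) ^ (s / 2) * spectralPart g μ (u m)) ^ 2 =
      (spectralPart g μ (u 0) ^ 2) ^ (1 - θ) * (spectralPart g μ (u N) ^ 2) ^ θ := fun μ => by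
    have ha0 : (1 + (μ : ℝ≥0∞)) ≠ 0 := by simp
    have hat : (1 + (μ : ℝ≥0∞)) ≠ ⊤ := by simp
    rw [spectralPart_iterate hu μ m, spectralPart_iterate hu μ N]
    generalize 1 + (μ : ℝ≥0∞) = a at ha0 hat
    generalize spectralPart g μ (u 0) = S
    have hR : (S ^ 2) ^ (1 - θ) * ((a ^ N * S) ^ 2) ^ θ = a ^ (2 * N * θ) * S ^ 2 := by
      rw [mul_pow, ENNReal.mul_rpow_of_nonneg _ _ h0, mul_left_comm,
        ← ENNReal.rpow_add_of_nonneg _ _ (sub_nonneg.2 h1) h0, sub_add_cancel, ENNReal.rpow_one,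
        ← pow_mul, ← ENNReal.rpow_natCast, ← ENNReal.rpow_mul]
      congr 3
      push_cast
      ring
    rw [hR, ← hs, ← mul_assoc, mul_pow, ← ENNReal.rpow_natCast a m,
      ← ENNReal.rpow_add _ _ ha0 hat, ← ENNReal.rpow_natCast (a ^ _) 2, ← ENNReal.rpow_mul]
    congr 2
    push_cast
    ring
  unfold sobolevNorm
  simp only [hterm]
  have h2 := ENNReal.lintegral_mul_norm_pow_le (μ := Measure.count)
    (f := fun μ : ℝ≥0 => spectralPart g μ (u 0) ^ 2)
    (g := fun μ : ℝ≥0 => spectralPart g μ (u N) ^ 2)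
    (measurable_from_top).aemeasurable (measurable_from_top).aemeasurable
    (sub_nonneg.2 h1) h0 (by ring)
  simp only [lintegral_count] at h2
  calc _ ≤ ((∑' μ, spectralPart g μ (u 0) ^ 2) ^ (1 - θ) *
        (∑' μ, spectralPart g μ (u N) ^ 2) ^ θ) ^ (1 / 2 : ℝ) :=
        ENNReal.rpow_le_rpow h2 (by norm_num)
    _ ≤ ((l2Norm g (u 0) ^ 2) ^ (1 - θ) * (l2Norm g (u N) ^ 2) ^ θ) ^ (1 / 2 : ℝ) := by
        have h3 : 0 ≤ 1 - θ := sub_nonneg.2 h1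
        gcongr <;> exact tsum_spectralPart_sq_le g _
    _ = _ := by
        rw [ENNReal.mul_rpow_of_nonneg _ _ (by norm_num), ← ENNReal.rpow_natCast,
          ← ENNReal.rpow_natCast, ← ENNReal.rpow_mul, ← ENNReal.rpow_mul, ← ENNReal.rpow_mul,
          ← ENNReal.rpow_mul]
        congr 2 <;> push_cast <;> ring

end Spectral

/-! ### Test functions and partial derivatives -/

section Test

variable {n : ℕ}

/-- Smooth functions on `ℝⁿ` whose support is a compact subset of `V`. -/
structure IsTest (V : Set (Rn n)) (f : Rn n → ℂ) : Prop where
  contDiff : ContDiff ℝ ∞ f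
  hasCompactSupport : HasCompactSupport f
  tsupport_subset : tsupport f ⊆ V

/-- The `i`-th partial derivative. -/
def pd (i : Fin n) (f : Rn n → ℂ) (y : Rn n) : ℂ := fderiv ℝ f y (stdVec i)

variable {V W : Set (Rn n)} {f f' : Rn n → ℂ}

theorem IsTest.mono (hf : IsTest V f) (h : V ⊆ W) : IsTest W f :=
  ⟨hf.1, hf.2, hf.3.trans h⟩

theorem IsTest.eq_zero (hf : IsTest V f) {y : Rn n} (hy : y ∉ V) : f y = 0 :=
  image_eq_zero_of_notMem_tsupport fun h => hy (hf.3 h)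

theorem isTest_zero : IsTest V (fun _ => (0 : ℂ)) := by
  have h : tsupport (fun _ : Rn n => (0 : ℂ)) = ∅ := tsupport_eq_empty_iff.2 rfl
  exact ⟨contDiff_const, by rw [HasCompactSupport, h]; exact isCompact_empty, by simp [h]⟩

theorem IsTest.add (hf : IsTest V f) (hf' : IsTest V f') : IsTest V (fun y => f y + f' y) :=
  ⟨hf.1.add hf'.1, hf.2.add hf'.2,
    (tsupport_add f f').trans (Set.union_subset hf.3 hf'.3)⟩

theorem IsTest.sum {ι : Type*} (s : Finset ι) {F : ι → Rn n → ℂ} (hF : ∀ i ∈ s, IsTest V (F i)) :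
    IsTest V (fun y => ∑ i ∈ s, F i y) := by
  classical
  induction s using Finset.induction_on with
  | empty => simpa using isTest_zero
  | insert a s ha ih =>
    simp only [Finset.sum_insert ha]
    exact (hF a (by simp)).add (ih fun i hi => hF i (by simp [hi]))

/-- Smoothness of `a` on `V` suffices, because the product vanishes near every point outside the
support of `f`. This admits coefficients defined only on a chart image. -/
theorem IsTest.mul_left {a : Rn n → ℂ} (hV : IsOpen V) (ha : ContDiffOn ℝ ∞ a V)
    (hf : IsTest V f) : IsTest V (fun y => a y * f y) := by
  have hsub : tsupport (fun y => a y * f y) ⊆ tsupport f := tsupport_mul_subset_right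
  refine ⟨?_, hf.2.mul_left, hsub.trans hf.3⟩
  rw [← contMDiff_iff_contDiff]
  refine contMDiff_of_tsupport fun y hy => ?_
  rw [contMDiffAt_iff_contDiffAt]
  exact (ha.contDiffAt (hV.mem_nhds (hf.3 (hsub hy)))).mul hf.1.contDiffAt

theorem IsTest.const_mul (hf : IsTest V f) (c : ℂ) : IsTest V (fun y => c * f y) :=
  ⟨contDiff_const.mul hf.1, hf.2.mul_left, tsupport_mul_subset_right.trans hf.3⟩

theorem IsTest.partialDeriv (hf : IsTest V f) (i : Fin n) : IsTest V (pd i f) :=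
  ⟨(hf.1.fderiv_right (m := ∞) (by simp)).clm_apply contDiff_const, hf.2.fderiv_apply ℝ _,
    (tsupport_fderiv_apply_subset ℝ _).trans hf.3⟩

theorem IsTest.integrable (hf : IsTest V f) : MeasureTheory.Integrable f :=
  hf.1.continuous.integrable_of_hasCompactSupport hf.2

end Test

/-! ### Functions supported in the domain of a chart -/

section Extend

variable {n : ℕ} {M : Type*} [TopologicalSpace M]

/-- The image of the support is compact, hence closed in the Hausdorff space `M`; thus extension by
zero creates no singularity at the boundary of the chart domain. -/
theorem tsupport_indicator_comp_chart_subset [T2Space M] {κ : OpenPartialHomeomorph M (Rn n)}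
    {f : Rn n → ℂ} (hf : IsTest κ.target f) :
    tsupport (κ.source.indicator fun p => f (κ p)) ⊆ κ.symm '' tsupport f := by
  have hK : IsCompact (κ.symm '' tsupport f) :=
    hf.2.isCompact.image_of_continuousOn (κ.symm.continuousOn.mono hf.3)
  refine closure_minimal (fun p hp => ?_) hK.isClosed
  have hps : p ∈ κ.source := by
    by_contra h
    exact hp (Set.indicator_of_notMem h _)
  refine ⟨κ p, subset_tsupport _ fun h => hp ?_, κ.left_inv hps⟩
  rw [Set.indicator_of_mem hps, h]

variable [ChartedSpace (Rn n) M]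

variable {κ : OpenPartialHomeomorph M (Rn n)} {f : Rn n → ℂ}

theorem contDiffOn_smooth_comp_symm (hκ : κ ∈ Charts n M) (h : Smooth n M) :
    ContDiffOn ℝ ∞ (fun y => (h : M → ℂ) (κ.symm y)) κ.target := by
  rw [← contMDiffOn_iff_contDiffOn]
  exact (show ContMDiff (𝓡 n) 𝓘(ℝ, ℂ) ∞ (h : M → ℂ) from h.2).comp_contMDiffOn
    (contMDiffOn_symm_of_mem_maximalAtlas hκ)

theorem differential_mfderiv_symm (hκ : κ ∈ Charts n M) (h : Smooth n M) {y : Rn n}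
    (hy : y ∈ κ.target) (i : Fin n) :
    differential h (κ.symm y) (mfderiv (𝓡 n) (𝓡 n) κ.symm y (stdVec i)) =
      pd i (fun z => (h : M → ℂ) (κ.symm z)) y := by
  have h1 := mfderiv_comp y (mdifferentiableAt_smooth h (κ.symm y))
    ((mdifferentiable_of_mem_charts hκ).mdifferentiableAt_symm hy)
  have h2 : mfderiv (𝓡 n) 𝓘(ℝ, ℂ) ((h : M → ℂ) ∘ κ.symm) y =
      fderiv ℝ (fun z => (h : M → ℂ) (κ.symm z)) y := mfderiv_eq_fderiv
  rw [h2] at h1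
  exact (congrArg (fun L => L (stdVec i)) h1).symm

variable [T2Space M]

/-- The function `κ^* f` on `M`, extended by zero outside the domain of the chart `κ`. -/
def extend (hκ : κ ∈ Charts n M) (hf : IsTest κ.target f) : Smooth n M :=
  ⟨κ.source.indicator fun p => f (κ p), by
    refine contMDiff_of_tsupport fun p hp => ?_
    obtain ⟨y, hy, rfl⟩ := tsupport_indicator_comp_chart_subset hf hp
    have hps : κ.symm y ∈ κ.source := κ.map_target (hf.tsupport_subset hy)
    have h2 : ContMDiffAt (𝓡 n) 𝓘(ℝ, ℂ) ∞ (fun p => f (κ p)) (κ.symm y) :=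
      hf.1.contMDiff.contMDiffAt.comp (κ.symm y) (contMDiffAt_of_mem_maximalAtlas hκ hps)
    refine h2.congr_of_eventuallyEq ?_
    filter_upwards [κ.open_source.mem_nhds hps] with q hq
    exact Set.indicator_of_mem hq _⟩

theorem extend_apply_symm (hκ : κ ∈ Charts n M) (hf : IsTest κ.target f) {y : Rn n}
    (hy : y ∈ κ.target) : (extend hκ hf : M → ℂ) (κ.symm y) = f y := by
  change κ.source.indicator (fun p => f (κ p)) (κ.symm y) = _
  rw [Set.indicator_of_mem (κ.map_target hy), κ.right_inv hy]

theorem extend_apply_of_notMem (hκ : κ ∈ Charts n M) (hf : IsTest κ.target f) {x : M}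
    (hx : x ∉ κ.source) : (extend hκ hf : M → ℂ) x = 0 :=
  Set.indicator_of_notMem hx fun p => f (κ p)

theorem differential_extend_of_notMem (hκ : κ ∈ Charts n M) (hf : IsTest κ.target f) {x : M}
    (hx : x ∉ κ.source) : differential (extend hκ hf) x = 0 := by
  have hx' : x ∉ tsupport (extend hκ hf : M → ℂ) := fun h => by
    obtain ⟨y, hy, rfl⟩ := tsupport_indicator_comp_chart_subset hf h
    exact hx (κ.map_target (hf.3 hy))
  have hev : (extend hκ hf : M → ℂ) =ᶠ[nhds x] fun _ => (0 : ℂ) :=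
    notMem_tsupport_iff_eventuallyEq.1 hx'
  rw [differential, hev.mfderiv_eq, mfderiv_const]
  rfl

theorem pd_extend_comp_symm (hκ : κ ∈ Charts n M) (hf : IsTest κ.target f) {y : Rn n}
    (hy : y ∈ κ.target) (i : Fin n) :
    pd i (fun z => (extend hκ hf : M → ℂ) (κ.symm z)) y = pd i f y := by
  have hev : (fun z => (extend hκ hf : M → ℂ) (κ.symm z)) =ᶠ[nhds y] f := by
    filter_upwards [κ.open_target.mem_nhds hy] with z hz
    exact extend_apply_symm hκ hf hz
  rw [pd, pd, hev.fderiv_eq]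

theorem extend_sub (hκ : κ ∈ Charts n M) {f' : Rn n → ℂ} {d : Rn n → ℂ} (hf : IsTest κ.target f)
    (hf' : IsTest κ.target f') (hd : IsTest κ.target d) (h : ∀ y, d y = f' y - f y) :
    extend hκ hf' - extend hκ hf = extend hκ hd := by
  ext x
  by_cases hx : x ∈ κ.source
  · simp [extend, hx, h]
  · simp [extend, hx]

end Extend

/-! ### The Laplacian in a chart -/

section LocalLaplacian

variable {n : ℕ} {M : Type*} [TopologicalSpace M] [ChartedSpace (Rn n) M] [IsManifold (𝓡 n) ∞ M]

/-- Cramer's rule: the entries of the inverse are quotients of determinants with positive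
denominator. -/
theorem contDiffOn_inv_chartGram (g : Metric n M) {κ : OpenPartialHomeomorph M (Rn n)}
    (hκ : κ ∈ Charts n M) (i j : Fin n) :
    ContDiffOn ℝ ∞ (fun y => (chartGram g κ y)⁻¹ i j) κ.target := by
  have h : ∀ y ∈ κ.target, (chartGram g κ y)⁻¹ i j =
      (chartGram g κ y).det⁻¹ * ((chartGram g κ y).updateRow j (Pi.single i 1)).det := by
    intro y _
    rw [Matrix.inv_def, Ring.inverse_eq_inv', Matrix.smul_apply, Matrix.adjugate_apply, smul_eq_mul]
  refine ContDiffOn.congr (ContDiffOn.mul ((contDiffOn_det (contDiffOn_chartGram g hκ)).inv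
    fun y hy => (det_chartGram_pos g hκ hy).ne') (contDiffOn_det fun k l => ?_)) h
  simp only [Matrix.updateRow_apply]
  split_ifs
  · exact contDiffOn_const
  · exact contDiffOn_chartGram g hκ k l

/-- The coefficients `√(det g) g^{ij}`. -/
def fluxCoeff (g : Metric n M) (κ : OpenPartialHomeomorph M (Rn n)) (i j : Fin n) (y : Rn n) : ℂ :=
  ((density g κ y * (chartGram g κ y)⁻¹ i j : ℝ) : ℂ)

theorem contDiffOn_fluxCoeff (g : Metric n M) {κ : OpenPartialHomeomorph M (Rn n)}
    (hκ : κ ∈ Charts n M) (i j : Fin n) : ContDiffOn ℝ ∞ (fluxCoeff g κ i j) κ.target :=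
  Complex.ofRealCLM.contDiff.comp_contDiffOn
    ((contDiffOn_density g hκ).mul (contDiffOn_inv_chartGram g hκ i j))

/-- The function `-1 / √(det g)`. -/
def negInvDensity (g : Metric n M) (κ : OpenPartialHomeomorph M (Rn n)) (y : Rn n) : ℂ :=
  ((-(density g κ y)⁻¹ : ℝ) : ℂ)

theorem contDiffOn_negInvDensity (g : Metric n M) {κ : OpenPartialHomeomorph M (Rn n)}
    (hκ : κ ∈ Charts n M) : ContDiffOn ℝ ∞ (negInvDensity g κ) κ.target :=
  Complex.ofRealCLM.contDiff.comp_contDiffOn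
    ((contDiffOn_density g hκ).inv fun _ hy => (density_pos g hκ hy).ne').neg

/-- The Laplace–Beltrami operator in a chart,
`Δ f = -(det g)^{-1/2} ∑ ∂_j ((det g)^{1/2} g^{ij} ∂_i f)`. -/
def chartLaplacian (g : Metric n M) (κ : OpenPartialHomeomorph M (Rn n)) (f : Rn n → ℂ)
    (y : Rn n) : ℂ :=
  negInvDensity g κ y * ∑ i, ∑ j, pd j (fun z => fluxCoeff g κ i j z * pd i f z) y

theorem IsTest.flux (g : Metric n M) {κ : OpenPartialHomeomorph M (Rn n)} (hκ : κ ∈ Charts n M)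
    {f : Rn n → ℂ} (hf : IsTest κ.target f) (i j : Fin n) :
    IsTest κ.target (fun z => fluxCoeff g κ i j z * pd i f z) :=
  (hf.partialDeriv i).mul_left κ.open_target (contDiffOn_fluxCoeff g hκ i j)

theorem IsTest.laplacian (g : Metric n M) {κ : OpenPartialHomeomorph M (Rn n)}
    (hκ : κ ∈ Charts n M) {f : Rn n → ℂ} (hf : IsTest κ.target f) :
    IsTest κ.target (chartLaplacian g κ f) :=
  IsTest.mul_left κ.open_target (contDiffOn_negInvDensity g hκ)
    (IsTest.sum _ fun i _ => IsTest.sum _ fun j _ => (hf.flux g hκ i j).partialDeriv j)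

variable [T2Space M]

theorem cometric_differential_extend (g : Metric n M) {κ : OpenPartialHomeomorph M (Rn n)}
    (hκ : κ ∈ Charts n M) {f : Rn n → ℂ} (hf : IsTest κ.target f) (h : Smooth n M) {y : Rn n}
    (hy : y ∈ κ.target) :
    cometric g (κ.symm y) (differential (extend hκ hf) (κ.symm y)) (differential h (κ.symm y)) =
      ∑ i, ∑ j, ((chartGram g κ y)⁻¹ i j) •
        (pd i f y * pd j (fun z => (h : M → ℂ) (κ.symm z)) y) := by
  rw [cometric_eq_chart g hκ hy]
  simp only [differential_mfderiv_symm hκ _ hy, pd_extend_comp_symm hκ hf hy]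

theorem contDiffOn_pd {h : Rn n → ℂ} {s : Set (Rn n)} (hs : IsOpen s) (hh : ContDiffOn ℝ ∞ h s)
    (i : Fin n) : ContDiffOn ℝ ∞ (pd i h) s :=
  (hh.fderiv_of_isOpen hs (m := ∞) (by simp)).clm_apply contDiffOn_const

open MeasureTheory in
/-- Green's formula in a chart. -/
theorem isLaplacian_extend [MeasurableSpace M] [BorelSpace M] (g : Metric n M)
    {κ : OpenPartialHomeomorph M (Rn n)} (hκ : κ ∈ Charts n M) {f : Rn n → ℂ}
    (hf : IsTest κ.target f) :
    IsLaplacian g (extend hκ hf) (extend hκ (hf.laplacian g hκ)) := by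
  intro h
  have hh := contDiffOn_smooth_comp_symm hκ h
  have hms := κ.open_target.measurableSet
  set H : Rn n → ℂ := fun y => (h : M → ℂ) (κ.symm y) with hH
  -- Needed to transfer the integral to the chart; continuity is visible in the coordinate frame but
  -- not in the pointwise basis `tangentBasis`.
  have hcont : ContinuousOn (fun x => cometric g x (differential (extend hκ hf) x)
      (differential h x)) κ.source := by
    have h1 : ContinuousOn (fun y => ∑ i, ∑ j, ((chartGram g κ y)⁻¹ i j) •
        (pd i f y * pd j H y)) κ.target :=
      continuousOn_finsetSum _ fun i _ => continuousOn_finsetSum _ fun j _ =>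
        (contDiffOn_inv_chartGram g hκ i j).continuousOn.smul
          ((hf.partialDeriv i).1.continuous.continuousOn.mul
            (contDiffOn_pd κ.open_target hh j).continuousOn)
    refine (h1.comp κ.continuousOn κ.mapsTo).congr fun x hx => ?_
    have h2 := cometric_differential_extend g hκ hf h (κ.map_source hx)
    rw [κ.left_inv hx] at h2
    exact h2
  have hL : ∫ x, cometric g x (differential (extend hκ hf) x) (differential h x) ∂(vol g) =
      ∫ y in κ.target, ∑ i, ∑ j, (fluxCoeff g κ i j y * pd i f y) * pd j H y := by
    rw [← setIntegral_eq_integral_of_forall_compl_eq_zero (s := κ.source) fun x hx => by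
        rw [differential_extend_of_notMem hκ hf hx]
        simp [cometric],
      setIntegral_vol_source g hκ hcont]
    refine setIntegral_congr_fun hms fun y hy => ?_
    simp only [cometric_differential_extend g hκ hf h hy, Finset.smul_sum]
    refine Finset.sum_congr rfl fun i _ => Finset.sum_congr rfl fun j _ => ?_
    rw [smul_smul, Complex.real_smul, fluxCoeff, mul_assoc]
  have hR : ∫ x, (extend hκ (hf.laplacian g hκ) : M → ℂ) x * (h : M → ℂ) x ∂(vol g) =
      ∫ y in κ.target, -∑ i, ∑ j,
        pd j (fun z => fluxCoeff g κ i j z * pd i f z) y * H y := by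
    rw [← setIntegral_eq_integral_of_forall_compl_eq_zero (s := κ.source) fun x hx => by
        rw [extend_apply_of_notMem hκ _ hx, zero_mul],
      setIntegral_vol_source g hκ
        (F := fun x => (extend hκ (hf.laplacian g hκ) : M → ℂ) x * (h : M → ℂ) x)
        ((continuous_smooth _).mul (continuous_smooth h)).continuousOn]
    refine setIntegral_congr_fun hms fun y hy => ?_
    simp only [extend_apply_symm hκ _ hy, chartLaplacian, negInvDensity, ← Finset.sum_mul]
    rw [Complex.real_smul, ← mul_assoc, ← mul_assoc, ← Complex.ofReal_mul, mul_neg,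
      mul_inv_cancel₀ (density_pos g hκ hy).ne', Complex.ofReal_neg, Complex.ofReal_one,
      neg_one_mul, neg_mul]
  -- `h` need not be supported in the chart, but each integrand has a factor built from `f`, so all
  -- of them are test functions and integrable over `ℝⁿ`.
  have hq1 : ∀ i j, IsTest κ.target
      (fun y => (fluxCoeff g κ i j y * pd i f y) * pd j H y) := fun i j => by
    have := (hf.flux g hκ i j).mul_left κ.open_target (contDiffOn_pd κ.open_target hh j)
    simpa only [mul_comm (pd j H _)] using this
  have hq2 : ∀ i j, IsTest κ.target
      (fun y => pd j (fun z => fluxCoeff g κ i j z * pd i f z) y * H y) := fun i j => by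
    have := ((hf.flux g hκ i j).partialDeriv j).mul_left κ.open_target hh
    simpa only [mul_comm (H _)] using this
  have hq3 : ∀ i j, IsTest κ.target
      (fun y => (fluxCoeff g κ i j y * pd i f y) * H y) := fun i j => by
    have := (hf.flux g hκ i j).mul_left κ.open_target hh
    simpa only [mul_comm (H _)] using this
  rw [hL, hR, setIntegral_eq_integral_of_forall_compl_eq_zero fun y hy =>
      Finset.sum_eq_zero fun i _ => Finset.sum_eq_zero fun j _ => (hq1 i j).eq_zero hy,
    setIntegral_eq_integral_of_forall_compl_eq_zero fun y hy => neg_eq_zero.2 <|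
      Finset.sum_eq_zero fun i _ => Finset.sum_eq_zero fun j _ => (hq2 i j).eq_zero hy,
    integral_neg,
    integral_finsetSum _ fun i _ => (IsTest.sum _ fun j _ => hq1 i j).integrable,
    integral_finsetSum _ fun i _ => (IsTest.sum _ fun j _ => hq2 i j).integrable,
    ← Finset.sum_neg_distrib]
  refine Finset.sum_congr rfl fun i _ => ?_
  rw [integral_finsetSum _ fun j _ => (hq1 i j).integrable,
    integral_finsetSum _ fun j _ => (hq2 i j).integrable, ← Finset.sum_neg_distrib]
  refine Finset.sum_congr rfl fun j _ => ?_
  -- Integration by parts in direction `j`. Differentiability of `H` is required only on the support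
  -- of the flux, which lies in the chart image.
  refine integral_mul_fderiv_eq_neg_fderiv_mul_of_integrable (hq2 i j).integrable
    (hq1 i j).integrable (hq3 i j).integrable
    (fun y _ => ((hf.flux g hκ i j).1.differentiable (by simp)) y) fun y hy => ?_
  exact (hh.contDiffAt (κ.open_target.mem_nhds ((hf.flux g hκ i j).3 hy))).differentiableAt (by simp)

end LocalLaplacian

/-! ### Oscillating families of test functions -/

section Oscillating

variable {n : ℕ}

/-- The plane wave `e^{i t y·η}`. -/
def planeWave (η : Rn n) (t : ℝ) (y : Rn n) : ℂ :=
  Complex.exp (Complex.I * ((t * inner ℝ y η : ℝ) : ℂ))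

theorem norm_planeWave (η : Rn n) (t : ℝ) (y : Rn n) : ‖planeWave η t y‖ = 1 := by
  rw [planeWave, mul_comm, Complex.norm_exp_ofReal_mul_I]

theorem planeWave_ne_zero (η : Rn n) (t : ℝ) (y : Rn n) : planeWave η t y ≠ 0 :=
  Complex.exp_ne_zero _

theorem contDiff_planeWave (η : Rn n) (t : ℝ) : ContDiff ℝ ∞ (planeWave η t) := by
  unfold planeWave
  exact (contDiff_const.mul (Complex.ofRealCLM.contDiff.comp
    (contDiff_const.mul (contDiff_id.inner ℝ contDiff_const)))).cexp

theorem IsTest.planeWave_mul {V : Set (Rn n)} {f : Rn n → ℂ} (hf : IsTest V f) (η : Rn n) (t : ℝ) :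
    IsTest V (fun y => planeWave η t y * f y) :=
  ⟨(contDiff_planeWave η t).mul hf.1, hf.2.mul_left, tsupport_mul_subset_right.trans hf.3⟩

theorem pd_planeWave (η : Rn n) (t : ℝ) (y : Rn n) (i : Fin n) :
    pd i (planeWave η t) y = Complex.I * t * η i * planeWave η t y := by
  have h1 : HasFDerivAt (fun z : Rn n => t * inner ℝ z η) (t • innerSL ℝ η) y := by
    have h := ((innerSL ℝ η).hasFDerivAt (x := y)).const_mul t
    refine h.congr_of_eventuallyEq (Filter.Eventually.of_forall fun z => ?_)
    simp [real_inner_comm]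
  have h2 := (((Complex.ofRealCLM.hasFDerivAt).comp y h1).const_mul Complex.I).cexp
  have h3 : HasFDerivAt (planeWave η t) _ y := h2
  rw [pd, h3.fderiv]
  simp [planeWave, EuclideanSpace.inner_single_right]
  ring

/-- A family `F t = e^{i t y·η} ∑_{j ≤ d} t^j c_j` with test functions `c_j` and `c_d = c`. -/
def IsOscillating (V : Set (Rn n)) (η : Rn n) (d : ℕ) (c : Rn n → ℂ) (F : ℝ → Rn n → ℂ) : Prop :=
  ∃ C : ℕ → Rn n → ℂ, (∀ j, IsTest V (C j)) ∧ C d = c ∧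
    ∀ t y, F t y = planeWave η t y * ∑ j ∈ Finset.range (d + 1), ((t ^ j : ℝ) : ℂ) * C j y

variable {V : Set (Rn n)} {η : Rn n} {d : ℕ} {c c' : Rn n → ℂ} {F F' : ℝ → Rn n → ℂ}

theorem isOscillating_planeWave_mul (hc : IsTest V c) :
    IsOscillating V η 0 c (fun t y => planeWave η t y * c y) :=
  ⟨fun _ => c, fun _ => hc, rfl, fun t y => by simp⟩

theorem IsOscillating.isTest (hF : IsOscillating V η d c F) (t : ℝ) : IsTest V (F t) := by
  obtain ⟨C, hC, -, h⟩ := hF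
  rw [show F t = _ from funext (h t)]
  exact (IsTest.sum _ fun j _ => (hC j).const_mul _).planeWave_mul η t

theorem IsOscillating.congr (hF : IsOscillating V η d c F) (h : c = c') :
    IsOscillating V η d c' F := h ▸ hF

theorem IsOscillating.mul_left (hV : IsOpen V) {a : Rn n → ℂ} (ha : ContDiffOn ℝ ∞ a V)
    (hF : IsOscillating V η d c F) :
    IsOscillating V η d (fun y => a y * c y) (fun t y => a y * F t y) := by
  obtain ⟨C, hC, rfl, h⟩ := hF
  refine ⟨fun j y => a y * C j y, fun j => (hC j).mul_left hV ha, rfl, fun t y => ?_⟩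
  dsimp only
  rw [h, mul_left_comm, Finset.mul_sum]
  simp only [mul_left_comm (a y)]

theorem IsOscillating.add (hF : IsOscillating V η d c F) (hF' : IsOscillating V η d c' F') :
    IsOscillating V η d (fun y => c y + c' y) (fun t y => F t y + F' t y) := by
  obtain ⟨C, hC, rfl, h⟩ := hF
  obtain ⟨C', hC', rfl, h'⟩ := hF'
  refine ⟨fun j y => C j y + C' j y, fun j => (hC j).add (hC' j), rfl, fun t y => ?_⟩
  dsimp only
  rw [h, h', ← mul_add, ← Finset.sum_add_distrib]
  simp only [mul_add]

theorem IsOscillating.sum {ι : Type*} (s : Finset ι) {c : ι → Rn n → ℂ} {F : ι → ℝ → Rn n → ℂ}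
    (hF : ∀ i ∈ s, IsOscillating V η d (c i) (F i)) :
    IsOscillating V η d (fun y => ∑ i ∈ s, c i y) (fun t y => ∑ i ∈ s, F i t y) := by
  classical
  induction s using Finset.induction_on with
  | empty => exact ⟨fun _ _ => 0, fun _ => isTest_zero, by simp, by simp⟩
  | insert a s ha ih =>
    simp only [Finset.sum_insert ha]
    exact (hF a (by simp)).add (ih fun i hi => hF i (by simp [hi]))

/-- The leading coefficient may vanish, so a family may be regarded as having higher degree. This
allows families of different orders to be added. -/
theorem IsOscillating.succ (hF : IsOscillating V η d c F) :
    IsOscillating V η (d + 1) (fun _ => 0) F := by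
  obtain ⟨C, hC, rfl, h⟩ := hF
  refine ⟨fun j => if j ≤ d then C j else fun _ => 0, fun j => ?_, by simp, fun t y => ?_⟩
  · dsimp only
    split_ifs
    exacts [hC j, isTest_zero]
  · rw [h, Finset.sum_range_succ _ (d + 1)]
    simp only [add_le_iff_nonpos_right, nonpos_iff_eq_zero, one_ne_zero, if_false, mul_zero,
      add_zero]
    congr 1
    refine Finset.sum_congr rfl fun j hj => ?_
    rw [if_pos (Nat.lt_succ_iff.1 (Finset.mem_range.1 hj))]

/-- Only the derivative of the plane wave, which contributes `i t η_i`, raises the degree in `t`;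
derivatives of the coefficients are of lower order. -/
theorem IsOscillating.partialDeriv (hF : IsOscillating V η d c F) (i : Fin n) :
    IsOscillating V η (d + 1) (fun y => Complex.I * η i * c y) (fun t => pd i (F t)) := by
  obtain ⟨C, hC, rfl, h⟩ := hF
  -- The product rule gives the coefficients `∂_i C_j + i η_i C_{j-1}`. The first guard removes
  -- `C_{d+1}`, which is unconstrained; the second removes the truncated index `0 - 1`.
  refine ⟨fun j y => (if j ≤ d then pd i (C j) y else 0) +
    if j = 0 then 0 else Complex.I * η i * C (j - 1) y, fun j => ?_, ?_, fun t y => ?_⟩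
  · refine IsTest.add ?_ ?_
    · split_ifs
      exacts [(hC j).partialDeriv i, isTest_zero]
    · split_ifs
      exacts [isTest_zero, (hC _).const_mul _]
  · ext y
    simp
  · have hS : DifferentiableAt ℝ
        (fun y => ∑ j ∈ Finset.range (d + 1), ((t ^ j : ℝ) : ℂ) * C j y) y :=
      ((IsTest.sum _ fun j _ => (hC j).const_mul _).1.differentiable (by simp)) y
    have hP : DifferentiableAt ℝ (planeWave η t) y :=
      ((contDiff_planeWave η t).differentiable (by simp)) y
    have hCd : ∀ j, DifferentiableAt ℝ (C j) y := fun j => ((hC j).1.differentiable (by simp)) y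
    have h1 : pd i (F t) y = planeWave η t y *
          (∑ j ∈ Finset.range (d + 1), ((t ^ j : ℝ) : ℂ) * pd i (C j) y) +
        pd i (planeWave η t) y * ∑ j ∈ Finset.range (d + 1), ((t ^ j : ℝ) : ℂ) * C j y := by
      rw [show F t = _ from funext (h t), pd, fderiv_fun_mul hP hS,
        fderiv_fun_sum fun j _ => (hCd j).const_mul _]
      simp only [fderiv_const_mul (hCd _), pd, add_apply, smul_apply, sum_apply, smul_eq_mul]
      ring
    dsimp only
    rw [h1, pd_planeWave]
    simp only [mul_add, Finset.sum_add_distrib]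
    congr 1
    · rw [Finset.sum_range_succ _ (d + 1)]
      simp only [add_le_iff_nonpos_right, nonpos_iff_eq_zero, one_ne_zero, if_false, mul_zero,
        add_zero]
      congr 1
      refine Finset.sum_congr rfl fun j hj => ?_
      rw [if_pos (Nat.lt_succ_iff.1 (Finset.mem_range.1 hj))]
    · rw [Finset.sum_range_succ' _ (d + 1)]
      simp only [Nat.add_eq_zero_iff, one_ne_zero, and_false, if_false, if_true, mul_zero, add_zero,
        Nat.add_sub_cancel, Finset.mul_sum]
      refine Finset.sum_congr rfl fun j _ => ?_
      push_cast
      ring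

end Oscillating

/-! ### Powers of `1 + Δ` on oscillating families -/

section Powers

variable {n : ℕ} {M : Type*} [TopologicalSpace M] [ChartedSpace (Rn n) M] [IsManifold (𝓡 n) ∞ M]

/-- The square `∑ g^{ij} η_i η_j` of the length of the covector `η` in a chart. -/
def chartNormSq (g : Metric n M) (κ : OpenPartialHomeomorph M (Rn n)) (η y : Rn n) : ℝ :=
  ∑ i, ∑ j, (chartGram g κ y)⁻¹ i j * (η i * η j)

theorem contDiffOn_chartNormSq (g : Metric n M) {κ : OpenPartialHomeomorph M (Rn n)}
    (hκ : κ ∈ Charts n M) (η : Rn n) : ContDiffOn ℝ ∞ (chartNormSq g κ η) κ.target :=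
  ContDiffOn.sum fun i _ => ContDiffOn.sum fun j _ =>
    (contDiffOn_inv_chartGram g hκ i j).mul contDiffOn_const

/-- The operator `1 + Δ` in a chart. -/
def oneAddLaplacian (g : Metric n M) (κ : OpenPartialHomeomorph M (Rn n)) (f : Rn n → ℂ)
    (y : Rn n) : ℂ :=
  f y + chartLaplacian g κ f y

variable {V : Set (Rn n)} {η : Rn n} {d : ℕ} {c : Rn n → ℂ} {F : ℝ → Rn n → ℂ}
  {κ : OpenPartialHomeomorph M (Rn n)}

/-- To top order both derivatives fall on the plane wave, giving `-∑ g^{ij} (i η_i)(i η_j) = |η|²`;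
the densities cancel. -/
theorem IsOscillating.oneAddLaplacian (g : Metric n M) (hκ : κ ∈ Charts n M) (hV : IsOpen V)
    (hVκ : V ⊆ κ.target) (hF : IsOscillating V η d c F) :
    IsOscillating V η (d + 2) (fun y => chartNormSq g κ η y * c y)
      (fun t => oneAddLaplacian g κ (F t)) := by
  -- The summand `1` of `1 + Δ` is two orders lower, so it enters with leading coefficient zero.
  have h := (hF.succ.succ).add (IsOscillating.mul_left hV
    ((contDiffOn_negInvDensity g hκ).mono hVκ)
    (IsOscillating.sum Finset.univ fun i _ => IsOscillating.sum Finset.univ fun j _ =>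
      ((hF.partialDeriv i).mul_left hV
        ((contDiffOn_fluxCoeff g hκ i j).mono hVκ)).partialDeriv j))
  refine IsOscillating.congr h ?_
  ext y
  by_cases hy : y ∈ V
  · have hd : ((density g κ y : ℝ) : ℂ) ≠ 0 :=
      Complex.ofReal_ne_zero.2 (density_pos g hκ (hVκ hy)).ne'
    simp only [zero_add, chartNormSq, Complex.ofReal_sum, Finset.mul_sum, Finset.sum_mul]
    refine Finset.sum_congr rfl fun i _ => Finset.sum_congr rfl fun j _ => ?_
    simp only [negInvDensity, fluxCoeff, Complex.ofReal_mul, Complex.ofReal_neg,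
      Complex.ofReal_inv]
    field_simp
    ring_nf
    rw [Complex.I_sq]
    ring
  · obtain ⟨C, hC, rfl, -⟩ := hF
    simp [(hC d).eq_zero hy]

theorem isOscillating_iterate (g : Metric n M) (hκ : κ ∈ Charts n M) (hV : IsOpen V)
    (hVκ : V ⊆ κ.target) (hc : IsTest V c) (m : ℕ) :
    IsOscillating V η (2 * m) (fun y => ((chartNormSq g κ η y ^ m : ℝ) : ℂ) * c y)
      (fun t => (PsiDO.oneAddLaplacian g κ)^[m] (fun y => planeWave η t y * c y)) := by
  induction m with
  | zero => simpa using isOscillating_planeWave_mul hc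
  | succ m ih =>
    simp only [Function.iterate_succ_apply']
    refine IsOscillating.congr (ih.oneAddLaplacian g hκ hV hVκ) ?_
    ext y
    push_cast
    ring

end Powers

/-! ### Quantization of symbols on oscillating functions -/

section Quantization

open MeasureTheory Filter Topology FourierTransform

variable {n : ℕ}

/-- The Fourier transform `∫ e^{-i y·ξ} u(y) dy`. -/
def hat (u : Rn n → ℂ) (ξ : Rn n) : ℂ :=
  ∫ y : Rn n, Complex.exp (-(Complex.I * ((inner ℝ y ξ : ℝ) : ℂ))) * u y

theorem hat_eq_fourier (u : 𝓢(Rn n, ℂ)) (ξ : Rn n) :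
    hat u ξ = 𝓕 u ((2 * Real.pi)⁻¹ • ξ) := by
  rw [SchwartzMap.fourier_coe, Real.fourier_eq']
  refine integral_congr_ae (Eventually.of_forall fun y => ?_)
  simp only [inner_smul_right, smul_eq_mul]
  congr 2
  push_cast
  have : (Real.pi : ℂ) ≠ 0 := Complex.ofReal_ne_zero.2 Real.pi_ne_zero
  field_simp

/-- Fourier inversion for `𝓕`, whose kernel contains `2π`; the rescaling `ξ = 2π w` produces the
factor `(2π)^n`. -/
theorem integral_exp_mul_hat (u : 𝓢(Rn n, ℂ)) (y : Rn n) :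
    ∫ ξ : Rn n, Complex.exp (Complex.I * ((inner ℝ y ξ : ℝ) : ℂ)) * hat u ξ =
      (((2 * Real.pi) ^ n : ℝ) : ℂ) * u y := by
  have h2π : (0 : ℝ) ≤ 2 * Real.pi := by positivity
  have h1 := Measure.integral_comp_inv_smul_of_nonneg (volume : Measure (Rn n))
    (fun w : Rn n => Complex.exp (((2 * Real.pi * inner ℝ w y : ℝ) : ℂ) * Complex.I) • 𝓕 u w) h2π
  have h2 : ∫ w : Rn n, Complex.exp (((2 * Real.pi * inner ℝ w y : ℝ) : ℂ) * Complex.I) • 𝓕 u w =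
      u y := by
    have h3 := Real.fourierInv_eq' ((𝓕 u : 𝓢(Rn n, ℂ)) : Rn n → ℂ) y
    rw [← h3, ← SchwartzMap.fourierInv_coe, FourierTransform.fourierInv_fourier_eq]
  rw [h2] at h1
  rw [finrank_euclideanSpace_fin, Complex.real_smul] at h1
  rw [← h1]
  refine integral_congr_ae (Eventually.of_forall fun ξ => ?_)
  simp only [hat_eq_fourier, inner_smul_left, smul_eq_mul]
  congr 2
  rw [real_inner_comm, mul_comm]
  push_cast
  have : (Real.pi : ℂ) ≠ 0 := Complex.ofReal_ne_zero.2 Real.pi_ne_zero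
  simp
  field_simp

/-- The rapid decay of `hat u` pays for the polynomial growth of a shifted symbol; this is the
majorant in `IsClassicalSymbol.tendsto_Op`. -/
theorem integrable_one_add_norm_pow_mul_hat (u : 𝓢(Rn n, ℂ)) (p : ℕ) :
    Integrable fun ξ : Rn n => (1 + ‖ξ‖) ^ p * ‖hat u ξ‖ := by
  have h2π : (2 * Real.pi)⁻¹ ≠ 0 := by positivity
  let e : Rn n ≃L[ℝ] Rn n := ContinuousLinearEquiv.smulLeft (Units.mk0 _ h2π)
  let v : 𝓢(Rn n, ℂ) := SchwartzMap.compCLMOfContinuousLinearEquiv ℝ e (𝓕 u)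
  have hv : ∀ ξ, hat u ξ = v ξ := fun ξ => hat_eq_fourier u ξ
  simp only [hv, add_comm (1 : ℝ), add_pow, one_pow, mul_one, Finset.sum_mul]
  refine integrable_finsetSum _ fun j _ => ?_
  have := (v.integrable_pow_mul volume j).mul_const (p.choose j : ℝ)
  refine this.congr (Eventually.of_forall fun ξ => ?_)
  dsimp only
  ring

theorem continuous_hat (u : 𝓢(Rn n, ℂ)) : Continuous (hat u) := by
  rw [show hat (u : Rn n → ℂ) = _ from funext (hat_eq_fourier u)]
  exact (𝓕 u).continuous.comp (continuous_const_smul _)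

/-- Modulation by a plane wave translates the Fourier transform by `t η`; the substitution `ξ = ζ +
t η` moves this translation into the symbol. -/
theorem Op_eq (a : Rn n → Rn n → ℂ) (η : Rn n) (t : ℝ) (u c : 𝓢(Rn n, ℂ))
    (hu : ∀ y, u y = planeWave η t y * c y) (y : Rn n) :
    Op a u y = planeWave η t y * ((((2 * Real.pi) ^ n : ℝ) : ℂ)⁻¹ *
      ∫ ζ : Rn n, Complex.exp (Complex.I * ((inner ℝ y ζ : ℝ) : ℂ)) * a y (ζ + t • η) *
        hat c ζ) := by
  have h1 : ∀ ξ, (∫ z : Rn n, Complex.exp (-(Complex.I * ((inner ℝ z ξ : ℝ) : ℂ))) * u z) =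
      hat c (ξ - t • η) := fun ξ => by
    refine integral_congr_ae (Eventually.of_forall fun z => ?_)
    simp only [hu, planeWave, ← mul_assoc, ← Complex.exp_add, inner_sub_right, inner_smul_right]
    congr 2
    push_cast
    ring
  unfold Op
  simp only [h1]
  rw [mul_left_comm (planeWave η t y), ← integral_const_mul (planeWave η t y)]
  refine congrArg (HMul.hMul _) ?_
  rw [← integral_add_right_eq_self (μ := (volume : Measure (Rn n))) (fun ξ => _ * hat c (ξ - t • η))
    (t • η)]
  refine integral_congr_ae (Eventually.of_forall fun ζ => ?_)
  simp only [add_sub_cancel_right, planeWave, ← mul_assoc, ← Complex.exp_add, inner_add_right,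
    inner_smul_right]
  congr 3
  push_cast
  ring

theorem norm_le_of_isSymbol {m : ℝ} {a : Rn n → Rn n → ℂ} (ha : IsSymbol m a) :
    ∃ C, 0 ≤ C ∧ ∀ x ξ, ‖a x ξ‖ ≤ C * (1 + ‖ξ‖) ^ m := by
  obtain ⟨C, hC⟩ := ha.2 0 0
  refine ⟨C, ?_, fun x ξ => ?_⟩
  · have := (norm_nonneg _).trans (hC 0 0)
    simpa using this
  · simpa [mixedDeriv] using hC x ξ

theorem norm_sub_le_of_isClassicalSymbol {m : ℝ} {a : Rn n → Rn n → ℂ} {b : ℕ → Rn n → Rn n → ℂ}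
    (hab : IsClassicalSymbol m a b) :
    ∃ C, ∀ x ξ, 1 ≤ ‖ξ‖ → ‖a x ξ - b 0 x ξ‖ ≤ C * (1 + ‖ξ‖) ^ (m - 1) := by
  obtain ⟨C, hC⟩ := hab.remainder 1 0 0
  exact ⟨C, fun x ξ hξ => by simpa [mixedDeriv] using hC x ξ hξ⟩

theorem tendsto_norm_add_smul_div {η : Rn n} (ζ : Rn n) :
    Tendsto (fun t : ℝ => (1 + ‖ζ + t • η‖) / t) atTop (𝓝 ‖η‖) := by
  have h1 : Tendsto (fun t : ℝ => t⁻¹ + ‖t⁻¹ • ζ + η‖) atTop (𝓝 (0 + ‖(0 : ℝ) • ζ + η‖)) :=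
    tendsto_inv_atTop_zero.add ((tendsto_inv_atTop_zero.smul_const ζ).add_const η).norm
  rw [zero_smul, zero_add, zero_add] at h1
  refine h1.congr' ?_
  filter_upwards [eventually_gt_atTop 0] with t ht
  have h2 : t⁻¹ • ζ + η = t⁻¹ • (ζ + t • η) := by
    rw [smul_add, smul_smul, inv_mul_cancel₀ ht.ne', one_smul]
  rw [h2, norm_smul, norm_inv, Real.norm_of_nonneg ht.le]
  field_simp

theorem tendsto_norm_add_smul_atTop {η : Rn n} (hη : η ≠ 0) (ζ : Rn n) :
    Tendsto (fun t : ℝ => ‖ζ + t • η‖) atTop atTop := by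
  have h1 : Tendsto (fun t : ℝ => t * ‖η‖ - ‖ζ‖) atTop atTop :=
    tendsto_atTop_add_const_right _ _ (tendsto_id.atTop_mul_const (norm_pos_iff.2 hη))
  refine tendsto_atTop_mono' _ ?_ h1
  filter_upwards [eventually_gt_atTop 0] with t ht
  have := norm_sub_le (ζ + t • η) ζ
  rw [add_sub_cancel_left, norm_smul, Real.norm_of_nonneg ht.le] at this
  linarith

/-- The leading term of a classical symbol as a limit. -/
theorem IsClassicalSymbol.tendsto {m : ℝ} {a : Rn n → Rn n → ℂ} {b : ℕ → Rn n → Rn n → ℂ}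
    (hab : IsClassicalSymbol m a b) {η : Rn n} (hη : η ≠ 0) (y ζ : Rn n) :
    Tendsto (fun t : ℝ => ((t ^ (-m) : ℝ) : ℂ) * a y (ζ + t • η)) atTop (𝓝 (b 0 y η)) := by
  obtain ⟨C, hC⟩ := norm_sub_le_of_isClassicalSymbol hab
  have hη' : 0 < ‖η‖ := norm_pos_iff.2 hη
  have hinf := tendsto_norm_add_smul_atTop hη ζ
  -- The remainder is of order `m - 1`: after division by `t^m` it is bounded by a convergent factor
  -- times `(1 + |ζ + t η|)⁻¹`.
  have hrem : Tendsto (fun t : ℝ => ((t ^ (-m) : ℝ) : ℂ) *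
      (a y (ζ + t • η) - b 0 y (ζ + t • η))) atTop (𝓝 0) := by
    have h1 : Tendsto (fun t : ℝ => C * (((1 + ‖ζ + t • η‖) / t) ^ m * (1 + ‖ζ + t • η‖)⁻¹)) atTop
        (𝓝 (C * (‖η‖ ^ m * 0))) :=
      (((tendsto_norm_add_smul_div ζ).rpow_const (Or.inl hη'.ne')).mul
        (tendsto_inv_atTop_zero.comp (tendsto_atTop_add_const_left _ 1 hinf))).const_mul C
    rw [mul_zero, mul_zero] at h1
    refine squeeze_zero_norm' ?_ h1
    filter_upwards [eventually_gt_atTop 0, hinf.eventually_ge_atTop 1] with t ht h1t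
    rw [norm_mul, Complex.norm_real, Real.norm_of_nonneg (Real.rpow_nonneg ht.le _)]
    have hpos : 0 < 1 + ‖ζ + t • η‖ := by positivity
    calc t ^ (-m) * ‖a y (ζ + t • η) - b 0 y (ζ + t • η)‖
        ≤ t ^ (-m) * (C * (1 + ‖ζ + t • η‖) ^ (m - 1)) :=
          mul_le_mul_of_nonneg_left (hC y _ h1t) (Real.rpow_nonneg ht.le _)
      _ = _ := by
          rw [Real.div_rpow hpos.le ht.le, Real.rpow_neg ht.le, Real.rpow_sub_one hpos.ne']
          ring
  -- By homogeneity the expression is `b 0 y (ζ/t + η)`, and `b 0` is continuous at `η ≠ 0`.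
  have hlead : Tendsto (fun t : ℝ => ((t ^ (-m) : ℝ) : ℂ) * b 0 y (ζ + t • η)) atTop
      (𝓝 (b 0 y η)) := by
    have h1 : Tendsto (fun t : ℝ => t⁻¹ • ζ + η) atTop (𝓝 η) := by
      have := (tendsto_inv_atTop_zero (𝕜 := ℝ)).smul_const ζ |>.add_const η
      simpa using this
    have hopen : IsOpen {z : Rn n × Rn n | z.2 ≠ 0} := isOpen_ne.preimage continuous_snd
    have hcont : ContinuousAt (fun z : Rn n × Rn n => b 0 z.1 z.2) (y, η) :=
      (hab.smooth 0).continuousOn.continuousAt (hopen.mem_nhds hη)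
    have h2 : Tendsto (fun t : ℝ => b 0 y (t⁻¹ • ζ + η)) atTop (𝓝 (b 0 y η)) :=
      hcont.tendsto.comp (tendsto_const_nhds.prodMk_nhds h1)
    refine h2.congr' ?_
    filter_upwards [eventually_gt_atTop 0, h1.eventually_ne hη] with t ht hne
    have h3 : ζ + t • η = t • (t⁻¹ • ζ + η) := by
      rw [smul_add, smul_smul, mul_inv_cancel₀ ht.ne', one_smul]
    rw [h3, hab.homogeneous 0 y _ t hne ht, ← mul_assoc, ← Complex.ofReal_mul,
      ← Real.rpow_add ht]
    simp
  have := hrem.add hlead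
  rw [zero_add] at this
  refine this.congr fun t => ?_
  ring

/-- A Peetre-type bound, uniform in `t ≥ 1`: the quotient lies between `|η| / (1 + |ζ|)` and `(1 +
|η|)(1 + |ζ|)`. The upper bound serves `m ≥ 0`, the lower one `m < 0`. -/
theorem rpow_one_add_norm_div_le {η : Rn n} (hη : η ≠ 0) {m : ℝ} {p : ℕ} (hp : |m| ≤ p) (ζ : Rn n)
    {t : ℝ} (ht : 1 ≤ t) :
    ((1 + ‖ζ + t • η‖) / t) ^ m ≤ ((1 + ‖η‖) ^ m + ‖η‖ ^ m) * (1 + ‖ζ‖) ^ p := by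
  have ht0 : 0 < t := by linarith
  have hη' : 0 < ‖η‖ := norm_pos_iff.2 hη
  have hζ := norm_nonneg ζ
  have hnt : ‖t • η‖ = t * ‖η‖ := by rw [norm_smul, Real.norm_of_nonneg ht0.le]
  have hr : 0 < (1 + ‖ζ + t • η‖) / t := by positivity
  rw [← Real.rpow_natCast (1 + ‖ζ‖) p]
  rcases le_or_gt 0 m with hm | hm
  · have h1 : (1 + ‖ζ + t • η‖) / t ≤ (1 + ‖η‖) * (1 + ‖ζ‖) := by
      rw [div_le_iff₀ ht0]
      have := norm_add_le ζ (t • η)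
      rw [hnt] at this
      nlinarith [mul_nonneg hζ hη'.le, mul_nonneg (mul_nonneg hζ hη'.le) ht0.le,
        mul_nonneg hζ (sub_nonneg.2 ht)]
    calc _ ≤ ((1 + ‖η‖) * (1 + ‖ζ‖)) ^ m := Real.rpow_le_rpow hr.le h1 hm
      _ = (1 + ‖η‖) ^ m * (1 + ‖ζ‖) ^ m := Real.mul_rpow (by positivity) (by positivity)
      _ ≤ ((1 + ‖η‖) ^ m + ‖η‖ ^ m) * (1 + ‖ζ‖) ^ (p : ℝ) := by
          gcongr
          · exact le_add_of_nonneg_right (by positivity)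
          · linarith
          · exact (le_abs_self m).trans hp
  · have h1 : ‖η‖ / (1 + ‖ζ‖) ≤ (1 + ‖ζ + t • η‖) / t := by
      rw [div_le_div_iff₀ (by positivity) ht0]
      have := norm_sub_le (ζ + t • η) ζ
      rw [add_sub_cancel_left, hnt] at this
      nlinarith [mul_nonneg (norm_nonneg (ζ + t • η)) hζ]
    calc _ ≤ (‖η‖ / (1 + ‖ζ‖)) ^ m := Real.rpow_le_rpow_of_nonpos (by positivity) h1 hm.le
      _ = ‖η‖ ^ m * (1 + ‖ζ‖) ^ (-m) := by
          rw [Real.div_rpow (by positivity) (by positivity), Real.rpow_neg (by positivity),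
            div_eq_mul_inv]
      _ ≤ ((1 + ‖η‖) ^ m + ‖η‖ ^ m) * (1 + ‖ζ‖) ^ (p : ℝ) := by
          gcongr
          · exact le_add_of_nonneg_left (by positivity)
          · linarith
          · exact (neg_le_abs m).trans hp

/-- `e^{-i t y·η} Op(a)(e^{i t y·η} c) ∼ t^m a_m(y, η) c(y)` as `t → ∞`. -/
theorem IsClassicalSymbol.tendsto_Op {m : ℝ} {a : Rn n → Rn n → ℂ} {b : ℕ → Rn n → Rn n → ℂ}
    (hab : IsClassicalSymbol m a b) {η : Rn n} (hη : η ≠ 0) (u : ℝ → 𝓢(Rn n, ℂ)) (c : 𝓢(Rn n, ℂ))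
    (hu : ∀ t y, u t y = planeWave η t y * c y) (y : Rn n) :
    Tendsto (fun t : ℝ => ((t ^ (-m) : ℝ) : ℂ) * ((planeWave η t y)⁻¹ * Op a (u t) y)) atTop
      (𝓝 (b 0 y η * c y)) := by
  obtain ⟨C, hC0, hC⟩ := norm_le_of_isSymbol hab.symbol
  obtain ⟨p, hp⟩ := exists_nat_ge |m|
  have hcont : Continuous fun z : Rn n × Rn n => a z.1 z.2 := hab.symbol.1.continuous
  have hlim : Tendsto (fun t : ℝ => ∫ ζ : Rn n,
      Complex.exp (Complex.I * ((inner ℝ y ζ : ℝ) : ℂ)) *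
        (((t ^ (-m) : ℝ) : ℂ) * a y (ζ + t • η)) * hat c ζ) atTop
      (𝓝 (∫ ζ : Rn n, Complex.exp (Complex.I * ((inner ℝ y ζ : ℝ) : ℂ)) * b 0 y η * hat c ζ)) := by
    refine tendsto_integral_filter_of_dominated_convergence
      (fun ζ => (C * ((1 + ‖η‖) ^ m + ‖η‖ ^ m)) * ((1 + ‖ζ‖) ^ p * ‖hat c ζ‖))
      (Eventually.of_forall fun t => ?_) ?_
      ((integrable_one_add_norm_pow_mul_hat c p).const_mul _)
      (Eventually.of_forall fun ζ => ?_)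
    · refine Continuous.aestronglyMeasurable ?_
      have h1 := continuous_hat c
      have h2 : Continuous fun ζ : Rn n => a y (ζ + t • η) :=
        hcont.comp (continuous_const.prodMk (continuous_id.add continuous_const))
      fun_prop
    · filter_upwards [eventually_ge_atTop 1] with t ht
      refine Eventually.of_forall fun ζ => ?_
      have ht0 : 0 < t := by linarith
      have hpos : 0 < 1 + ‖ζ + t • η‖ := by positivity
      rw [norm_mul, norm_mul, norm_mul, mul_comm Complex.I, Complex.norm_exp_ofReal_mul_I, one_mul,
        Complex.norm_real, Real.norm_of_nonneg (Real.rpow_nonneg ht0.le _), ← mul_assoc]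
      refine mul_le_mul_of_nonneg_right ?_ (norm_nonneg _)
      calc t ^ (-m) * ‖a y (ζ + t • η)‖ ≤ t ^ (-m) * (C * (1 + ‖ζ + t • η‖) ^ m) :=
            mul_le_mul_of_nonneg_left (hC y _) (Real.rpow_nonneg ht0.le _)
        _ = C * ((1 + ‖ζ + t • η‖) / t) ^ m := by
            rw [Real.div_rpow hpos.le ht0.le, Real.rpow_neg ht0.le]
            ring
        _ ≤ C * (((1 + ‖η‖) ^ m + ‖η‖ ^ m) * (1 + ‖ζ‖) ^ p) :=
            mul_le_mul_of_nonneg_left (rpow_one_add_norm_div_le hη hp ζ ht) hC0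
        _ = _ := by ring
    · exact ((hab.tendsto hη y ζ).const_mul _).mul_const _
  have hval : (((2 * Real.pi) ^ n : ℝ) : ℂ)⁻¹ *
      ∫ ζ : Rn n, Complex.exp (Complex.I * ((inner ℝ y ζ : ℝ) : ℂ)) * b 0 y η * hat c ζ =
        b 0 y η * c y := by
    have h1 : ∀ ζ : Rn n, Complex.exp (Complex.I * ((inner ℝ y ζ : ℝ) : ℂ)) * b 0 y η * hat c ζ =
        b 0 y η * (Complex.exp (Complex.I * ((inner ℝ y ζ : ℝ) : ℂ)) * hat c ζ) := fun ζ => by ring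
    simp only [h1]
    have h2 : (((2 * Real.pi) ^ n : ℝ) : ℂ) ≠ 0 := Complex.ofReal_ne_zero.2 (by positivity)
    rw [integral_const_mul, integral_exp_mul_hat]
    field_simp
  rw [← hval]
  refine (hlim.const_mul _).congr fun t => ?_
  rw [Op_eq a η t (u t) c (hu t) y, inv_mul_cancel_left₀ (planeWave_ne_zero η t y),
    mul_left_comm ((t ^ (-m) : ℝ) : ℂ), ← integral_const_mul ((t ^ (-m) : ℝ) : ℂ)]
  refine congrArg (HMul.hMul _) ?_
  refine integral_congr_ae (Eventually.of_forall fun ζ => ?_)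
  dsimp only
  ring

end Quantization

/-! ### The `L²`-norm in a chart -/

section ChartL2

open MeasureTheory

variable {n : ℕ} {M : Type*} [TopologicalSpace M] [ChartedSpace (Rn n) M] [IsManifold (𝓡 n) ∞ M]

/-- The Riemannian volume on the image of a chart. -/
def imageVolume (g : Metric n M) (κ : OpenPartialHomeomorph M (Rn n)) : Measure (Rn n) :=
  ((volume : Measure (Rn n)).restrict κ.target).withDensity fun y =>
    ENNReal.ofReal (density g κ y)

theorem ae_imageVolume_mem_target (g : Metric n M) (κ : OpenPartialHomeomorph M (Rn n)) :
    ∀ᵐ y ∂(imageVolume g κ), y ∈ κ.target :=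
  (withDensity_absolutelyContinuous _ _).ae_le (ae_restrict_mem κ.open_target.measurableSet)

theorem restrict_absolutelyContinuous_imageVolume (g : Metric n M)
    {κ : OpenPartialHomeomorph M (Rn n)} (hκ : κ ∈ Charts n M) :
    (volume : Measure (Rn n)).restrict κ.target ≪ imageVolume g κ := by
  refine withDensity_absolutelyContinuous' (aemeasurable_density g hκ).ennreal_ofReal ?_
  filter_upwards [ae_restrict_mem κ.open_target.measurableSet] with y hy
  exact (ENNReal.ofReal_pos.2 (density_pos g hκ hy)).ne'

theorem eLpNorm_imageVolume_ne_zero (g : Metric n M) {κ : OpenPartialHomeomorph M (Rn n)}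
    (hκ : κ ∈ Charts n M) {f : Rn n → ℂ} (hf : IsTest κ.target f) {y : Rn n} (hy : f y ≠ 0) :
    eLpNorm f 2 (imageVolume g κ) ≠ 0 := by
  intro h
  rw [eLpNorm_eq_zero_iff hf.1.continuous.aestronglyMeasurable (by simp)] at h
  have h1 := (restrict_absolutelyContinuous_imageVolume g hκ).ae_le h
  have hopen : IsOpen {z | f z ≠ 0} := isOpen_ne.preimage hf.1.continuous
  have h2 : volume {z | f z ≠ 0} = 0 := by
    have h3 := ae_iff.1 h1
    rw [Measure.restrict_apply' κ.open_target.measurableSet] at h3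
    refine measure_mono_null ?_ h3
    intro z hz
    refine ⟨hz, ?_⟩
    by_contra hzt
    exact hz (hf.eq_zero hzt)
  exact (hopen.measure_pos volume ⟨y, hy⟩).ne' h2

variable [MeasurableSpace M] [BorelSpace M]

theorem eLpNorm_restrict_source (g : Metric n M) {κ : OpenPartialHomeomorph M (Rn n)}
    (hκ : κ ∈ Charts n M) (u : Smooth n M) :
    eLpNorm (u : M → ℂ) 2 ((vol g).restrict κ.source) =
      eLpNorm (fun y => (u : M → ℂ) (κ.symm y)) 2 (imageVolume g κ) := by
  rw [vol_restrict_source g hκ]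
  exact eLpNorm_map_measure (continuous_smooth u).aestronglyMeasurable
    (aemeasurable_chart_symm κ _)

/-- For `A u`, which need not be supported in the chart, the part outside is discarded; a lower
bound suffices on this side. -/
theorem eLpNorm_comp_symm_le_l2Norm (g : Metric n M) {κ : OpenPartialHomeomorph M (Rn n)}
    (hκ : κ ∈ Charts n M) (u : Smooth n M) :
    eLpNorm (fun y => (u : M → ℂ) (κ.symm y)) 2 (imageVolume g κ) ≤ l2Norm g u := by
  rw [← eLpNorm_restrict_source g hκ]
  exact eLpNorm_mono_measure _ Measure.restrict_le_self

theorem l2Norm_extend [T2Space M] (g : Metric n M) {κ : OpenPartialHomeomorph M (Rn n)}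
    (hκ : κ ∈ Charts n M) {f : Rn n → ℂ} (hf : IsTest κ.target f) :
    l2Norm g (extend hκ hf) = eLpNorm f 2 (imageVolume g κ) := by
  have h1 : Function.support (extend hκ hf : M → ℂ) ⊆ κ.source := fun x hx => by
    by_contra h
    exact hx (extend_apply_of_notMem hκ hf h)
  rw [l2Norm, ← eLpNorm_restrict_eq_of_support_subset h1, eLpNorm_restrict_source g hκ]
  refine eLpNorm_congr_ae ?_
  filter_upwards [ae_imageVolume_mem_target g κ] with y hy
  exact extend_apply_symm hκ hf hy

end ChartL2

/-! ### Asymptotics of norms of oscillating families -/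

section Asymptotics

open MeasureTheory Filter Topology

variable {n : ℕ} {V : Set (Rn n)} {η : Rn n} {d : ℕ} {c : Rn n → ℂ} {F : ℝ → Rn n → ℂ}

theorem tendsto_pow_mul_rpow_neg {j d : ℕ} (hj : j < d) :
    Tendsto (fun t : ℝ => t ^ j * t ^ (-(d : ℝ))) atTop (𝓝 0) := by
  have h : Tendsto (fun t : ℝ => t ^ (-((d : ℝ) - j))) atTop (𝓝 0) :=
    tendsto_rpow_neg_atTop (sub_pos.2 (by exact_mod_cast hj))
  refine h.congr' ?_
  filter_upwards [eventually_gt_atTop 0] with t ht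
  rw [← Real.rpow_natCast, ← Real.rpow_add ht]
  congr 1
  ring

theorem tendsto_pow_mul_rpow_neg_self (d : ℕ) :
    Tendsto (fun t : ℝ => t ^ d * t ^ (-(d : ℝ))) atTop (𝓝 1) := by
  refine tendsto_const_nhds.congr' ?_
  filter_upwards [eventually_gt_atTop 0] with t ht
  rw [← Real.rpow_natCast, ← Real.rpow_add ht, add_neg_cancel, Real.rpow_zero]

/-- The `L²`-norm of an oscillating family is asymptotically bounded by that of its leading term. -/
theorem IsOscillating.exists_tendsto_bound (hF : IsOscillating V η d c F) {ν : Measure (Rn n)}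
    (hν : ∀ f, IsTest V f → eLpNorm f 2 ν ≠ ⊤) :
    ∃ R : ℝ → ℝ≥0∞, Tendsto R atTop (𝓝 (eLpNorm c 2 ν)) ∧
      ∀ t, 0 < t → ENNReal.ofReal (t ^ (-(d : ℝ))) * eLpNorm (F t) 2 ν ≤ R t := by
  obtain ⟨C, hC, rfl, h⟩ := hF
  -- This is the triangle inequality, the plane wave having modulus one; of the powers `t^{j-d}`
  -- only `j = d` survives in the limit.
  refine ⟨fun t => ∑ j ∈ Finset.range (d + 1),
    ENNReal.ofReal (t ^ j * t ^ (-(d : ℝ))) * eLpNorm (C j) 2 ν, ?_, fun t ht => ?_⟩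
  · have hlim : ∀ j ∈ Finset.range (d + 1), Tendsto (fun t : ℝ =>
        ENNReal.ofReal (t ^ j * t ^ (-(d : ℝ))) * eLpNorm (C j) 2 ν) atTop
        (𝓝 (ENNReal.ofReal (if j = d then 1 else 0) * eLpNorm (C j) 2 ν)) := fun j hj => by
      refine ENNReal.Tendsto.mul_const (ENNReal.tendsto_ofReal ?_) (Or.inr (hν _ (hC j)))
      split_ifs with hjd
      · rw [hjd]
        exact tendsto_pow_mul_rpow_neg_self d
      · exact tendsto_pow_mul_rpow_neg
          (lt_of_le_of_ne (Nat.lt_succ_iff.1 (Finset.mem_range.1 hj)) hjd)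
    have := tendsto_finsetSum _ hlim
    simpa [Finset.sum_ite_eq, apply_ite ENNReal.ofReal, ite_mul] using this
  · have h1 : eLpNorm (F t) 2 ν ≤
        ∑ j ∈ Finset.range (d + 1), ENNReal.ofReal (t ^ j) * eLpNorm (C j) 2 ν := by
      have h2 : eLpNorm (F t) 2 ν =
          eLpNorm (∑ j ∈ Finset.range (d + 1), fun y => ((t ^ j : ℝ) : ℂ) * C j y) 2 ν := by
        refine eLpNorm_congr_norm_ae (Eventually.of_forall fun y => ?_)
        rw [h, norm_mul, norm_planeWave, one_mul, Finset.sum_apply]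
      rw [h2]
      refine (eLpNorm_sum_le (fun j _ =>
        (((hC j).const_mul _).1.continuous.aestronglyMeasurable)) (by norm_num)).trans ?_
      refine Finset.sum_le_sum fun j _ => le_of_eq ?_
      have h3 := eLpNorm_const_smul ((t ^ j : ℝ) : ℂ) (C j) 2 ν
      rw [← ofReal_norm, Complex.norm_real, Real.norm_of_nonneg (by positivity)] at h3
      exact h3
    refine (mul_le_mul_right h1 _).trans (le_of_eq ?_)
    rw [Finset.mul_sum]
    refine Finset.sum_congr rfl fun j _ => ?_
    rw [ENNReal.ofReal_mul (by positivity), ← mul_assoc, mul_comm (ENNReal.ofReal (t ^ j))]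

end Asymptotics

/-! ### Pseudodifferential operators on oscillating families -/

section Operator

open Filter Topology

variable {n : ℕ} {M : Type*} [TopologicalSpace M] [ChartedSpace (Rn n) M] [T2Space M]
  {κ : OpenPartialHomeomorph M (Rn n)}

theorem extend_sum_smul (hκ : κ ∈ Charts n M) {ι : Type*} (s : Finset ι) {f : ι → Rn n → ℂ}
    (z : ι → ℂ) {h : Rn n → ℂ} (hf : ∀ i, IsTest κ.target (f i)) (hh : IsTest κ.target h)
    (heq : ∀ y, h y = ∑ i ∈ s, z i * f i y) :
    extend hκ hh = ∑ i ∈ s, z i • extend hκ (hf i) := by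
  ext x
  rw [Submodule.coe_sum, Finset.sum_apply]
  by_cases hx : x ∈ κ.source
  · simp [extend, hx, heq]
  · simp [extend, hx]

variable [IsManifold (𝓡 n) ∞ M]

theorem pullback_eq_extend (hκ : κ ∈ Charts n M) (ψ : 𝓓(chartImage κ, ℂ)) (u : 𝓢(Rn n, ℂ))
    {f : Rn n → ℂ} (hf : IsTest κ.target f) (h : ∀ y, ψ y * u y = f y) :
    pullback hκ ψ u = extend hκ hf := by
  ext x
  simp [pullback, extend, h]

variable {V : Set (Rn n)} {η : Rn n} {d : ℕ} {c : Rn n → ℂ} {F : ℝ → Rn n → ℂ} {k : ℝ}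
  {A : Smooth n M →ₗ[ℂ] Smooth n M} {φ ψ : 𝓓(chartImage κ, ℂ)} {a : Rn n → Rn n → ℂ}
  {b : ℕ → Rn n → Rn n → ℂ}

/-- The local symbol describes `φ A ψ`, so it is applied to `ψ⁻¹ c` times the plane wave; on `V`,
which contains the support of `c`, the cutoff `ψ` cancels. -/
theorem tendsto_apply_planeWave_mul (hκ : κ ∈ Charts n M) (hab : IsClassicalSymbol k a b)
    (hA : IsLocalSymbol A hκ φ ψ a) (hη : η ≠ 0) (hV : IsOpen V) (hψ : ∀ y ∈ V, ψ y ≠ 0)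
    (hc : IsTest V c) (hVκ : V ⊆ κ.target) (y : Rn n) :
    Tendsto (fun t : ℝ => ((t ^ (-k) : ℝ) : ℂ) * ((planeWave η t y)⁻¹ *
      (φ y * (A (extend hκ ((hc.mono hVκ).planeWave_mul η t)) : M → ℂ) (κ.symm y)))) atTop
      (𝓝 (b 0 y η * ((ψ y)⁻¹ * c y))) := by
  have hcψ : IsTest V (fun y => (ψ y)⁻¹ * c y) :=
    hc.mul_left hV (ψ.contDiff.contDiffOn.inv hψ)
  have h := hab.tendsto_Op hη
    (fun t => (hcψ.planeWave_mul η t).2.toSchwartzMap (hcψ.planeWave_mul η t).1)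
    (hcψ.2.toSchwartzMap hcψ.1) (fun t y => rfl) y
  refine h.congr fun t => ?_
  rw [← hA, pullback_eq_extend hκ ψ _ ((hc.mono hVκ).planeWave_mul η t) fun z => ?_]
  change ψ z * (planeWave η t z * ((ψ z)⁻¹ * c z)) = planeWave η t z * c z
  by_cases hz : z ∈ V
  · have := hψ z hz
    field_simp
  · simp [hc.eq_zero hz]

/-- The action of a pseudodifferential operator on an oscillating family, to leading order. -/
theorem IsOscillating.tendsto_apply (hκ : κ ∈ Charts n M) (hab : IsClassicalSymbol k a b)
    (hA : IsLocalSymbol A hκ φ ψ a) (hη : η ≠ 0) (hV : IsOpen V) (hψ : ∀ y ∈ V, ψ y ≠ 0)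
    (hVκ : V ⊆ κ.target) (hF : IsOscillating V η d c F) (y : Rn n) :
    Tendsto (fun t : ℝ => ((t ^ (-(k + d)) : ℝ) : ℂ) * ((planeWave η t y)⁻¹ *
      (φ y * (A (extend hκ ((hF.isTest t).mono hVκ)) : M → ℂ) (κ.symm y)))) atTop
      (𝓝 (b 0 y η * ((ψ y)⁻¹ * c y))) := by
  obtain ⟨C, hC, hCd, h⟩ := id hF
  -- By linearity of `A` each coefficient is treated separately; the extra factor `t^{j-d}` leaves
  -- only `j = d`.
  have hterm : ∀ j ∈ Finset.range (d + 1), Tendsto (fun t : ℝ =>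
      ((t ^ j * t ^ (-(d : ℝ)) : ℝ) : ℂ) * (((t ^ (-k) : ℝ) : ℂ) * ((planeWave η t y)⁻¹ *
      (φ y * (A (extend hκ (((hC j).mono hVκ).planeWave_mul η t)) : M → ℂ) (κ.symm y))))) atTop
      (𝓝 (((if j = d then 1 else 0 : ℝ) : ℂ) * (b 0 y η * ((ψ y)⁻¹ * C j y)))) := fun j hj => by
    refine Tendsto.mul ?_ (tendsto_apply_planeWave_mul hκ hab hA hη hV hψ (hC j) hVκ y)
    refine (Complex.continuous_ofReal.tendsto _).comp ?_
    split_ifs with hjd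
    · rw [hjd]
      exact tendsto_pow_mul_rpow_neg_self d
    · exact tendsto_pow_mul_rpow_neg
        (lt_of_le_of_ne (Nat.lt_succ_iff.1 (Finset.mem_range.1 hj)) hjd)
  have hsum := tendsto_finsetSum _ hterm
  have hval : ∑ j ∈ Finset.range (d + 1),
      (((if j = d then 1 else 0 : ℝ) : ℂ) * (b 0 y η * ((ψ y)⁻¹ * C j y))) =
        b 0 y η * ((ψ y)⁻¹ * c y) := by
    rw [Finset.sum_eq_single d]
    · simp [hCd]
    · intro j _ hj
      simp [hj]
    · intro hd
      simp at hd
  rw [hval] at hsum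
  refine hsum.congr' ?_
  filter_upwards [eventually_gt_atTop 0] with t ht
  rw [extend_sum_smul hκ (Finset.range (d + 1)) (fun j => ((t ^ j : ℝ) : ℂ))
    (fun j => ((hC j).mono hVκ).planeWave_mul η t) ((hF.isTest t).mono hVκ) fun z => by
      rw [h, Finset.mul_sum]
      exact Finset.sum_congr rfl fun j _ => by ring]
  simp only [map_sum, map_smul, Submodule.coe_sum, Finset.sum_apply, Submodule.coe_smul,
    Pi.smul_apply, smul_eq_mul, Finset.mul_sum]
  refine Finset.sum_congr rfl fun j _ => ?_
  rw [neg_add, Real.rpow_add ht]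
  push_cast
  ring

end Operator

/-! ### The lower bound for the operator norm -/

section LowerBound

open MeasureTheory Filter Topology

variable {n : ℕ} {M : Type*} [TopologicalSpace M] [ChartedSpace (Rn n) M]
  [IsManifold (𝓡 n) ∞ M] {κ : OpenPartialHomeomorph M (Rn n)}

theorem chartNormSq_pos (g : Metric n M) (hκ : κ ∈ Charts n M) {η : Rn n} (hη : η ≠ 0) {y : Rn n}
    (hy : y ∈ κ.target) : 0 < chartNormSq g κ η y := by
  have h := (posDef_chartGram g hκ hy).inv.dotProduct_mulVec_pos (x := η.ofLp) fun h => hη (by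
    ext i
    exact congrFun h i)
  simp only [star_trivial, dotProduct, Matrix.mulVec, Finset.mul_sum] at h
  unfold chartNormSq
  refine lt_of_lt_of_eq h (Finset.sum_congr rfl fun i _ => Finset.sum_congr rfl fun j _ => ?_)
  ring

/-- In the coordinate frame `ξ = κ^* η` has the components `η_i`, and the pairing of covectors may
be computed in that frame. -/
theorem covectorNorm_eq_sqrt_chartNormSq (g : Metric n M) (hκ : κ ∈ Charts n M) {x : M}
    (hx : x ∈ κ.source) {ξ : TangentSpace (𝓡 n) x →L[ℝ] ℝ} {η : Rn n}
    (hξ : ∀ v : TangentSpace (𝓡 n) x, ξ v = inner ℝ η (mfderiv (𝓡 n) (𝓡 n) κ x v : Rn n)) :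
    covectorNorm g x ξ = Real.sqrt (chartNormSq g κ η (κ x)) := by
  obtain ⟨y, hy, rfl⟩ : ∃ y ∈ κ.target, κ.symm y = x := ⟨κ x, κ.map_source hx, κ.left_inv hx⟩
  have h1 : ∀ i, ξ (mfderiv (𝓡 n) (𝓡 n) κ.symm y (stdVec i)) = η i := fun i => by
    rw [hξ]
    have h2 := congrArg (fun L : Rn n →L[ℝ] Rn n => L (stdVec i))
      ((mdifferentiable_of_mem_charts hκ).comp_symm_deriv hy)
    refine (congrArg (fun v : Rn n => inner ℝ η v) h2).trans ?_
    change inner ℝ η (stdVec i) = η i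
    simp [EuclideanSpace.inner_single_right]
  rw [covectorNorm, κ.right_inv hy, cometric_eq_chart g hκ hy]
  simp only [h1, smul_eq_mul, chartNormSq]

variable [T2Space M]

theorem isLaplacian_extend_oneAddLaplacian [MeasurableSpace M] [BorelSpace M] (g : Metric n M)
    (hκ : κ ∈ Charts n M) {f : Rn n → ℂ} (hf : IsTest κ.target f)
    (hf' : IsTest κ.target (oneAddLaplacian g κ f)) :
    IsLaplacian g (extend hκ hf) (extend hκ hf' - extend hκ hf) := by
  rw [extend_sub hκ hf hf' (hf.laplacian g hκ) fun y => by simp [oneAddLaplacian]]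
  exact isLaplacian_extend g hκ hf

variable [MeasurableSpace M] [BorelSpace M] [CompactSpace M]
  {k : ℝ} {A : Smooth n M →ₗ[ℂ] Smooth n M} {φ ψ : 𝓓(chartImage κ, ℂ)} {a : Rn n → Rn n → ℂ}
  {b : ℕ → Rn n → Rn n → ℂ}

/-- The inequality obtained from the boundedness of `A` on the functions
`(1 + Δ)^m (e^{i t y·η} c)`, `t → ∞`. -/
theorem eLpNorm_symbol_le (g : Metric n M) (hκ : κ ∈ Charts n M) (hab : IsClassicalSymbol k a b)
    (hA : IsLocalSymbol A hκ φ ψ a) {η : Rn n} (hη : η ≠ 0) {V : Set (Rn n)} (hV : IsOpen V)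
    (hφ : ∀ y ∈ V, φ y ≠ 0) (hψ : ∀ y ∈ V, ψ y ≠ 0) (hVκ : V ⊆ κ.target) {c : Rn n → ℂ}
    (hc : IsTest V c) {θ : ℝ} {m N : ℕ} (h0 : 0 ≤ θ) (h1 : θ ≤ 1)
    (hk : k + 2 * m = 2 * N * θ) {C : ℝ≥0∞} (hCt : C ≠ ⊤)
    (hC : ∀ u : Smooth n M, l2Norm g (A u) ≤ C * sobolevNorm g k u) :
    eLpNorm (fun y => (φ y)⁻¹ * (b 0 y η * ((ψ y)⁻¹ *
        (((chartNormSq g κ η y ^ m : ℝ) : ℂ) * c y)))) 2 ((imageVolume g κ).restrict V) ≤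
      C * (eLpNorm c 2 (imageVolume g κ) ^ (1 - θ) *
        eLpNorm (fun y => ((chartNormSq g κ η y ^ N : ℝ) : ℂ) * c y) 2 (imageVolume g κ) ^ θ) := by
  have hosc := isOscillating_iterate (η := η) g hκ hV hVκ hc
  set P : ℕ → ℝ → Rn n → ℂ :=
    fun j t => (oneAddLaplacian g κ)^[j] (fun y => planeWave η t y * c y) with hP
  have htest : ∀ j t, IsTest κ.target (P j t) := fun j t => ((hosc j).isTest t).mono hVκ
  have hfin : ∀ f, IsTest V f → eLpNorm f 2 (imageVolume g κ) ≠ ⊤ := fun f hf => by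
    rw [← l2Norm_extend g hκ (hf.mono hVκ)]
    exact l2Norm_ne_top g _
  obtain ⟨R, hR, hRle⟩ := (hosc N).exists_tendsto_bound hfin
  -- Boundedness of `A` on `(1 + Δ)^m v_t` combined with interpolation. The weights match since
  -- `t^{-(k+2m)} = (t^{-2N})^θ`.
  have hbound : ∀ t : ℝ, 0 < t → ENNReal.ofReal (t ^ (-(k + 2 * m))) *
      l2Norm g (A (extend hκ (htest m t))) ≤
        C * (eLpNorm c 2 (imageVolume g κ) ^ (1 - θ) * R t ^ θ) := fun t ht => by
    have hs := sobolevNorm_iterate_le (g := g) (u := fun j => extend hκ (htest j t))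
      (fun j => by
        have hstep : P (j + 1) t = oneAddLaplacian g κ (P j t) := by
          simp only [hP, Function.iterate_succ_apply']
        have hj := htest (j + 1) t
        have key : ∀ f' (hf' : IsTest κ.target f'), f' = oneAddLaplacian g κ (P j t) →
            IsLaplacian g (extend hκ (htest j t)) (extend hκ hf' - extend hκ (htest j t)) := by
          rintro f' hf' rfl
          exact isLaplacian_extend_oneAddLaplacian g hκ (htest j t) hf'
        exact key _ hj hstep) (s := k) (m := m) (N := N) h0 h1 hk
    simp only [l2Norm_extend] at hs
    have hX : eLpNorm (P 0 t) 2 (imageVolume g κ) = eLpNorm c 2 (imageVolume g κ) := by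
      refine eLpNorm_congr_norm_ae (Eventually.of_forall fun y => ?_)
      simp [hP, norm_planeWave]
    rw [hX] at hs
    have htθ : ENNReal.ofReal (t ^ (-(k + 2 * m))) =
        ENNReal.ofReal (t ^ (-((2 * N : ℕ) : ℝ))) ^ θ := by
      rw [ENNReal.ofReal_rpow_of_nonneg (Real.rpow_nonneg ht.le _) h0, ← Real.rpow_mul ht.le, hk]
      congr 2
      push_cast
      ring
    calc ENNReal.ofReal (t ^ (-(k + 2 * m))) * l2Norm g (A (extend hκ (htest m t)))
        ≤ ENNReal.ofReal (t ^ (-(k + 2 * m))) * (C * (eLpNorm c 2 (imageVolume g κ) ^ (1 - θ) *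
            eLpNorm (P N t) 2 (imageVolume g κ) ^ θ)) := by
          gcongr
          exact (hC _).trans (by gcongr)
      _ = C * (eLpNorm c 2 (imageVolume g κ) ^ (1 - θ) *
            (ENNReal.ofReal (t ^ (-((2 * N : ℕ) : ℝ))) *
              eLpNorm (P N t) 2 (imageVolume g κ)) ^ θ) := by
          rw [ENNReal.mul_rpow_of_nonneg _ _ h0, htθ]
          ring
      _ ≤ _ := by
          gcongr
          exact hRle t ht
  have hRlim : Tendsto (fun t => C * (eLpNorm c 2 (imageVolume g κ) ^ (1 - θ) * R t ^ θ)) atTop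
      (𝓝 (C * (eLpNorm c 2 (imageVolume g κ) ^ (1 - θ) *
        eLpNorm (fun y => ((chartNormSq g κ η y ^ N : ℝ) : ℂ) * c y) 2 (imageVolume g κ) ^ θ))) :=
    ENNReal.Tendsto.const_mul (ENNReal.Tendsto.const_mul
      ((ENNReal.continuous_rpow_const.tendsto _).comp hR)
      (Or.inr (ENNReal.rpow_ne_top_of_nonneg (sub_nonneg.2 h1) (hfin c hc)))) (Or.inr hCt)
  -- Integer times suffice and give a sequence for Fatou's lemma. The inverse plane wave makes it
  -- converge pointwise without changing its modulus.
  let G : ℕ → Rn n → ℂ := fun j y => (((j : ℝ) ^ (-(k + (2 * m : ℕ))) : ℝ) : ℂ) *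
    ((planeWave η j y)⁻¹ * (A (extend hκ (htest m j)) : M → ℂ) (κ.symm y))
  have hGm : ∀ j, AEStronglyMeasurable (G j) ((imageVolume g κ).restrict V) := fun j => by
    have h2 : AEStronglyMeasurable (G j) (volume.restrict κ.target) := by
      refine ContinuousOn.aestronglyMeasurable ?_ κ.open_target.measurableSet
      exact continuousOn_const.mul ((((contDiff_planeWave η j).continuous.inv₀
        (planeWave_ne_zero η j)).continuousOn).mul
          (contDiffOn_smooth_comp_symm hκ _).continuousOn)
    exact (h2.mono_ac (withDensity_absolutelyContinuous _ _)).mono_measure Measure.restrict_le_self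
  have hGlim : ∀ᵐ y ∂((imageVolume g κ).restrict V), Tendsto (fun j => G j y) atTop
      (𝓝 ((φ y)⁻¹ * (b 0 y η * ((ψ y)⁻¹ *
        (((chartNormSq g κ η y ^ m : ℝ) : ℂ) * c y))))) := by
    filter_upwards [ae_restrict_mem hV.measurableSet] with y hy
    have h2 := ((hosc m).tendsto_apply hκ hab hA hη hV hψ hVκ y).comp tendsto_natCast_atTop_atTop
    refine (h2.const_mul (φ y)⁻¹).congr fun j => ?_
    have := hφ y hy
    simp only [Function.comp, G]
    field_simp
  refine (Lp.eLpNorm_lim_le_liminf_eLpNorm hGm _ hGlim).trans ?_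
  refine le_of_le_of_eq (liminf_le_liminf (v := fun j : ℕ => C *
    (eLpNorm c 2 (imageVolume g κ) ^ (1 - θ) * R j ^ θ)) ?_)
    (hRlim.comp tendsto_natCast_atTop_atTop).liminf_eq
  filter_upwards [eventually_gt_atTop 0] with j hj
  have hj' : (0 : ℝ) < j := by exact_mod_cast hj
  refine le_trans ?_ (hbound j hj')
  have h2 : eLpNorm (G j) 2 (imageVolume g κ) = ENNReal.ofReal ((j : ℝ) ^ (-(k + 2 * m))) *
      eLpNorm (fun y => (A (extend hκ (htest m j)) : M → ℂ) (κ.symm y)) 2 (imageVolume g κ) := by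
    have h3 := eLpNorm_const_smul (((j : ℝ) ^ (-(k + 2 * m)) : ℝ) : ℂ)
      (fun y => (A (extend hκ (htest m j)) : M → ℂ) (κ.symm y)) 2 (imageVolume g κ)
    rw [← ofReal_norm, Complex.norm_real, Real.norm_of_nonneg (by positivity)] at h3
    rw [← h3]
    refine eLpNorm_congr_norm_ae (Eventually.of_forall fun y => ?_)
    simp [G, norm_planeWave]
  calc eLpNorm (G j) 2 ((imageVolume g κ).restrict V) ≤ eLpNorm (G j) 2 (imageVolume g κ) :=
        eLpNorm_mono_measure _ Measure.restrict_le_self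
    _ ≤ _ := by
        rw [h2]
        gcongr
        exact eLpNorm_comp_symm_le_l2Norm g hκ _

/-- The test function is localized near `y`, where all coefficients are almost constant, so that its
norm cancels from `eLpNorm_symbol_le`. Arguing by contradiction leaves room for the margins `β` and
`γ`. -/
theorem norm_symbol_le (g : Metric n M) (hκ : κ ∈ Charts n M) (hab : IsClassicalSymbol k a b)
    (hA : IsLocalSymbol A hκ φ ψ a) {η : Rn n} (hη : η ≠ 0) {y : Rn n} (hy : y ∈ κ.target)
    (hφ : φ y = 1) (hψ : ψ y = 1) {θ : ℝ} {m N : ℕ} (h0 : 0 ≤ θ) (h1 : θ ≤ 1)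
    (hk : k + 2 * m = 2 * N * θ) {C : ℝ≥0} (hC : ∀ u : Smooth n M,
      l2Norm g (A u) ≤ C * sobolevNorm g k u) :
    ‖b 0 y η‖ * chartNormSq g κ η y ^ m ≤ C * (chartNormSq g κ η y ^ N) ^ θ := by
  by_contra! hlt
  obtain ⟨β, hβ1, hβ2⟩ := exists_between hlt
  have hq : 0 < chartNormSq g κ η y := chartNormSq_pos g hκ hη hy
  -- A number slightly above the value at `y` bounds `|η|^{2N}` on a whole neighbourhood and still
  -- keeps the right side below `β`.
  obtain ⟨γ, hγβ, hγ⟩ : ∃ γ : ℝ, C * γ ^ θ < β ∧ chartNormSq g κ η y ^ N < γ := by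
    have hcont : ContinuousAt (fun γ : ℝ => (C : ℝ) * γ ^ θ) (chartNormSq g κ η y ^ N) :=
      continuousAt_const.mul (Real.continuousAt_rpow_const _ _ (Or.inl (by positivity)))
    have h2 := (hcont.tendsto.eventually (gt_mem_nhds hβ1)).filter_mono
      (nhdsWithin_le_nhds (s := Set.Ioi (chartNormSq g κ η y ^ N)))
    exact (h2.and self_mem_nhdsWithin).exists
  have hβ0 : 0 ≤ β := le_trans (by positivity) hβ1.le
  have hγ0 : 0 < γ := lt_trans (by positivity) hγ
  have hqc : ContinuousAt (chartNormSq g κ η) y :=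
    (contDiffOn_chartNormSq g hκ η).continuousOn.continuousAt (κ.open_target.mem_nhds hy)
  have hbc : ContinuousAt (fun z => b 0 z η) y := by
    have hopen : IsOpen {z : Rn n × Rn n | z.2 ≠ 0} := isOpen_ne.preimage continuous_snd
    have h2 : ContinuousAt (fun z : Rn n × Rn n => b 0 z.1 z.2) (y, η) :=
      (hab.smooth 0).continuousOn.continuousAt (hopen.mem_nhds hη)
    exact h2.comp (f := fun z : Rn n => (z, η)) (by fun_prop)
  let L : Rn n → ℂ := fun z =>
    (φ z)⁻¹ * (b 0 z η * ((ψ z)⁻¹ * ((chartNormSq g κ η z ^ m : ℝ) : ℂ)))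
  have hLc : ContinuousAt L y := by
    refine ((φ.continuous.continuousAt).inv₀ (by rw [hφ]; exact one_ne_zero)).mul (hbc.mul
      (((ψ.continuous.continuousAt).inv₀ (by rw [hψ]; exact one_ne_zero)).mul ?_))
    exact Complex.continuous_ofReal.continuousAt.comp (hqc.pow m)
  have hLy : ‖L y‖ = ‖b 0 y η‖ * chartNormSq g κ η y ^ m := by
    simp [L, hφ, hψ, abs_of_pos hq]
  have hev : ∀ᶠ z in 𝓝 y, z ∈ κ.target ∧ φ z ≠ 0 ∧ ψ z ≠ 0 ∧ β < ‖L z‖ ∧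
      |chartNormSq g κ η z ^ N| < γ := by
    refine Eventually.and (κ.open_target.mem_nhds hy) (Eventually.and ?_ (Eventually.and ?_
      (Eventually.and ?_ ?_)))
    · exact φ.continuous.continuousAt.eventually_ne (by rw [hφ]; exact one_ne_zero)
    · exact ψ.continuous.continuousAt.eventually_ne (by rw [hψ]; exact one_ne_zero)
    · exact hLc.norm.tendsto.eventually (lt_mem_nhds (hLy ▸ hβ2))
    · refine (hqc.pow N).abs.tendsto.eventually (gt_mem_nhds ?_)
      rwa [Pi.pow_apply, abs_of_pos (pow_pos hq N)]
  obtain ⟨V, hVs, hV, hyV⟩ := eventually_nhds_iff.1 hev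
  obtain ⟨f, hf, hfc, hfs, -, hf1⟩ := exists_contDiff_tsupport_subset (n := ⊤) (hV.mem_nhds hyV)
  have hc : IsTest V (fun z => (f z : ℂ)) :=
    ⟨Complex.ofRealCLM.contDiff.comp hfs, hfc.comp_left Complex.ofReal_zero,
      (tsupport_comp_subset Complex.ofReal_zero f).trans hf⟩
  have hVκ : V ⊆ κ.target := fun z hz => (hVs z hz).1
  have key := eLpNorm_symbol_le g hκ hab hA hη hV (fun z hz => (hVs z hz).2.1)
    (fun z hz => (hVs z hz).2.2.1) hVκ hc h0 h1 hk ENNReal.coe_ne_top hC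
  set X := eLpNorm (fun z => (f z : ℂ)) 2 (imageVolume g κ) with hX
  have hX0 : X ≠ 0 := eLpNorm_imageVolume_ne_zero g hκ (hc.mono hVκ) (y := y) (by simp [hf1])
  have hXt : X ≠ ⊤ := by
    rw [hX, ← l2Norm_extend g hκ (hc.mono hVκ)]
    exact l2Norm_ne_top g _
  have hsupp : Function.support (fun z => (f z : ℂ)) ⊆ V :=
    (subset_tsupport _).trans hc.3
  have hlow : ENNReal.ofReal β * X ≤ eLpNorm (fun z => (φ z)⁻¹ * (b 0 z η * ((ψ z)⁻¹ *
      (((chartNormSq g κ η z ^ m : ℝ) : ℂ) * (f z : ℂ))))) 2 ((imageVolume g κ).restrict V) := by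
    have h3 := eLpNorm_const_smul (β : ℂ) (fun z => (f z : ℂ)) 2 ((imageVolume g κ).restrict V)
    rw [← ofReal_norm, Complex.norm_real, Real.norm_of_nonneg hβ0,
      eLpNorm_restrict_eq_of_support_subset hsupp] at h3
    rw [hX, ← h3]
    refine eLpNorm_mono_ae ?_
    filter_upwards [ae_restrict_mem hV.measurableSet] with z hz
    have h4 : (φ z)⁻¹ * (b 0 z η * ((ψ z)⁻¹ * (((chartNormSq g κ η z ^ m : ℝ) : ℂ) * (f z : ℂ)))) =
        L z * (f z : ℂ) := by
      simp only [L]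
      ring
    rw [h4, norm_mul, Pi.smul_apply, norm_smul, Complex.norm_real, Real.norm_of_nonneg hβ0]
    exact mul_le_mul_of_nonneg_right (hVs z hz).2.2.2.1.le (norm_nonneg _)
  have hup : eLpNorm (fun z => ((chartNormSq g κ η z ^ N : ℝ) : ℂ) * (f z : ℂ)) 2
      (imageVolume g κ) ≤ ENNReal.ofReal γ * X := by
    have h3 := eLpNorm_const_smul (γ : ℂ) (fun z => (f z : ℂ)) 2 (imageVolume g κ)
    rw [← ofReal_norm, Complex.norm_real, Real.norm_of_nonneg hγ0.le] at h3
    rw [hX, ← h3]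
    refine eLpNorm_mono fun z => ?_
    rw [Pi.smul_apply, norm_smul, norm_mul, Complex.norm_real, Complex.norm_real,
      Complex.norm_real, Real.norm_of_nonneg hγ0.le, Real.norm_eq_abs (_ ^ N)]
    by_cases hz : z ∈ V
    · exact mul_le_mul_of_nonneg_right (hVs z hz).2.2.2.2.le (norm_nonneg _)
    · have h4 : f z = 0 := by simpa using hc.eq_zero hz
      simp [h4]
  have hfinal : ENNReal.ofReal β * X ≤ (C * ENNReal.ofReal (γ ^ θ)) * X :=
    calc ENNReal.ofReal β * X ≤ C * (X ^ (1 - θ) * (ENNReal.ofReal γ * X) ^ θ) :=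
          hlow.trans (key.trans (by gcongr))
      _ = (C * ENNReal.ofReal (γ ^ θ)) * (X ^ (1 - θ) * X ^ θ) := by
          rw [ENNReal.mul_rpow_of_nonneg _ _ h0, ENNReal.ofReal_rpow_of_nonneg hγ0.le h0]
          ring
      _ = _ := by
          rw [← ENNReal.rpow_add_of_nonneg _ _ (sub_nonneg.2 h1) h0, sub_add_cancel,
            ENNReal.rpow_one]
  -- The exponents `1 - θ` and `θ` add up to one, so a single factor `X` remains, with `0 < X < ∞`.
  have h5 := (ENNReal.mul_le_mul_iff_left hX0 hXt).1 hfinal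
  rw [← ENNReal.ofReal_coe_nnreal, ← ENNReal.ofReal_mul C.coe_nonneg,
    ENNReal.ofReal_le_ofReal_iff (by positivity)] at h5
  exact absurd hγβ (not_lt.2 h5)

/-- The bound holds for every admissible value `z`, whichever chart and cutoffs produce it, so
invariance of the principal symbol is not needed. -/
theorem covectorNorm_rpow_mul_le (g : Metric n M) {x : M} {ξ : TangentSpace (𝓡 n) x →L[ℝ] ℝ}
    (hξ : ξ ≠ 0) {z : ℂ} (hz : HasPrincipalSymbolAt k A x ξ z) {C : ℝ≥0}
    (hC : ∀ u : Smooth n M, l2Norm g (A u) ≤ C * sobolevNorm g k u) :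
    covectorNorm g x ξ ^ (-k) * ‖z‖ ≤ C := by
  obtain ⟨κ, hκ, φ, ψ, a, b, η, hx, hφ, hψ, hab, hA, hη, rfl⟩ := hz
  have hη0 : η ≠ 0 := by
    rintro rfl
    exact hξ (ContinuousLinearMap.ext fun v => (hη v).trans (inner_zero_left (E := Rn n) _))
  have hy := κ.map_source hx
  rw [covectorNorm_eq_sqrt_chartNormSq g hκ hx hη]
  obtain ⟨p, hp⟩ := exists_nat_ge |k|
  have hk1 := (abs_le.1 hp).1
  have hk2 := (abs_le.1 hp).2
  have hp0 : (0 : ℝ) < (p + 1 : ℕ) := by positivity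
  have hpc : ((p + 1 : ℕ) : ℝ) = p + 1 := by push_cast; ring
  -- Here `θ = (k + 2m) / (2N)`. Since `|k| ≤ p`, one has `0 ≤ k + 2m ≤ 2N`; using `p + 1` instead
  -- of `p` keeps `N` positive when `p = 0`.
  have key := norm_symbol_le g hκ hab hA hη0 hy hφ hψ (m := p + 1) (N := 2 * (p + 1))
    (θ := (k + 2 * (p + 1 : ℕ)) / (4 * (p + 1 : ℕ))) (div_nonneg (by linarith) (by linarith))
    ((div_le_one (by linarith)).2 (by linarith)) (by push_cast; field_simp; ring) hC
  have hq : 0 < chartNormSq g κ η (κ x) := chartNormSq_pos g hκ hη0 hy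
  generalize chartNormSq g κ η (κ x) = q at key hq
  have h1 : (q ^ (2 * (p + 1))) ^ ((k + 2 * (p + 1 : ℕ)) / (4 * (p + 1 : ℕ)) : ℝ) =
      q ^ (k / 2) * q ^ (p + 1) := by
    rw [← Real.rpow_natCast q (2 * (p + 1)), ← Real.rpow_mul hq.le, ← Real.rpow_natCast q (p + 1),
      ← Real.rpow_add hq]
    congr 1
    push_cast
    field_simp
    ring
  rw [h1, ← mul_assoc] at key
  have h2 := le_of_mul_le_mul_right key (pow_pos hq _)
  have h3 : Real.sqrt q ^ (-k) = (q ^ (k / 2))⁻¹ := by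
    rw [Real.sqrt_eq_rpow, ← Real.rpow_mul hq.le, ← Real.rpow_neg hq.le]
    congr 1
    ring
  rw [h3, inv_mul_le_iff₀ (Real.rpow_pos_of_pos hq _), mul_comm]
  exact h2

end LowerBound

end PsiDO

end

theorem corollaryA4 {n : ℕ} {M : Type*} [TopologicalSpace M] [T2Space M] [CompactSpace M]
    [ChartedSpace (PsiDO.Rn n) M] [IsManifold (𝓡 n) ∞ M] [MeasurableSpace M] [BorelSpace M]
    (g : PsiDO.Metric n M) (k : ℝ) (A : PsiDO.Smooth n M →ₗ[ℂ] PsiDO.Smooth n M)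
    (hA : PsiDO.IsClassicalPDO k A) :
    (⨆ (x : M) (ξ : TangentSpace (𝓡 n) x →L[ℝ] ℝ) (_ : ξ ≠ 0),
      ENNReal.ofReal (PsiDO.covectorNorm g x ξ ^ (-k) * ‖PsiDO.principalSymbol hA x ξ‖)) ≤
      PsiDO.sobolevOpNorm g k A := by
  refine iSup_le fun x => iSup₂_le fun ξ hξ => le_sInf fun C hC => ?_
  -- The limiting argument needs a finite constant; for `C = ⊤` nothing is claimed.
  induction C with
  | top => exact le_top
  | coe C =>
    rw [← ENNReal.ofReal_coe_nnreal]
    exact ENNReal.ofReal_le_ofReal (PsiDO.covectorNorm_rpow_mul_le g hξ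
      (PsiDO.exists_hasPrincipalSymbolAt hA x ξ).choose_spec hC)
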